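/- **Setting.** For $n\ge1$ and $1\le i\le n$ let $p_{n,i}>0$, $0<a_{n,i}<b_{n,i}$ with $a_{n,i}+b_{n,i}<1/2$, and $c_{n,i}\ge0$ with $a_{n,i}+c_{n,i}\le 1$. Let $K_{n,i}$ be the transition matrix on $\{0,1,\dots,2n\}$ given by $$K_{n,i}(j,j+1)=1-a_{n,i}\ (j\notin\{n,2n\}),\qquad K_{n,i}(0,0)=a_{n,i},\qquad K_{n,i}(j,j-1)=a_{n,i}\ (j\neq0),$$ $$K_{n,i}(n,n+1)=b_{n,i},\quad K_{n,i}(n,2n)=1-a_{n,i}-b_{n,i},\quad K_{n,i}(2n,n)=c_{n,i},\quad K_{n,i}(2n,2n)=1-a_{n,i}-c_{n,i}$$ (for $n=1$ the probabilities of parallel transitions are added), let $\pi_{n,i}$ be its stationary distribution, and assume that $K_{n,i}$ is reversible with respect to $\pi_{n,i}$. Put $q_n=\sum_{i=1}^np_{n,i}$ and $\hat p_n=\min_{1\le i\le n}p_{n,i}$, and let $\mathcal G=(\mathcal X_n,K_n,\pi_n)_{n\ge1}$, where $$\mathcal X_n=\{0,\dots,2n\}^n,\qquad \pi_n=\pi_{n,1}\times\dots\times\pi_{n,n},\qquad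 K_n=\sum_{i=1}^n\frac{p_{n,i}}{q_n}\,I\otimes\dots\otimes I\otimes K_{n,i}\otimes I\otimes\dots\otimes I$$ (with $K_{n,i}$ in the $i$-th place). Let $\mathcal G_c$ be the family of continuous time chains with kernels $H_{n,t}=e^{-t(I-K_n)}$ and total variation distances $$d_n(t)=\max_{x\in\mathcal X_n,\,A\subset\mathcal X_n}\{H_{n,t}(x,A)-\pi_n(A)\}.$$ Assume $$\sum_{i=1}^na_{n,i}=o(1/n),\qquad \max_{1\le i\le n}b_{n,i}=o(1),\qquad \max_{1\le i\le n}\frac{a_{n,i}}{b_{n,i}}=O(1/n).$$ An increasing sequence means a strictly increasing sequence $\xi=(\xi_k)_{k\ge1}$ of positive integers. The subfamily of $\mathcal G_c$ along $\xi$ has a *(total variation) cutoff with cutoff time* $t_k>0$ if $d_{\xi_k}(rt_k)\to0$ for all $r>1$ and $d_{\xi_k}(rt_k)\to1$ for all $0<r<1$, as $k\to\infty$; it has a cutoff if it has some cutoff time. The case $\xi_k=k$ is that of $\mathcal G_c$ itself. Put $B_n(\delta)=\sum_{i:\,p_{n,i}<(1+\delta)\hat p_n}b_{n,i}$, $\ \overline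 F_\xi(\delta)=\limsup_kB_{\xi_k}(\delta)$, $\ \underline F_\xi(\delta)=\liminf_kB_{\xi_k}(\delta)$, and $$\overline\Delta_0(\xi)=\sup\{\delta\in(0,1):\overline F_\xi(\delta)=0\},\qquad \overline\Delta_\infty(\xi)=\inf\{\delta\in(0,1):\overline F_\xi(\delta)=\infty\},$$ $$\underline\Delta_0(\xi)=\sup\{\delta\in(0,1):\underline F_\xi(\delta)=0\},\qquad \underline\Delta_\infty(\xi)=\inf\{\delta\in(0,1):\underline F_\xi(\delta)=\infty\},$$ with $\sup\emptyset=0$ and $\inf\emptyset=1$. Omit $\xi$ when $\xi_k=k$. **Claim.** (A) The following are equivalent: 1. for every increasing sequence $\xi$, $\overline\Delta_0(\xi)=\overline\Delta_\infty(\xi)$ and $\underline\Delta_0(\xi)=\underline\Delta_\infty(\xi)$; 2. for every increasing sequence $\xi$, $\overline\Delta_0(\xi)=\overline\Delta_\infty(\xi)$ or $\underline\Delta_0(\xi)=\underline\Delta_\infty(\xi)$; 3. $\mathcal G_c$ has a cutoff. In particular, if $\overline\Delta_0=\underline\Delta_\infty=\Delta$, then $\mathcal G_c$ has a cutoff with cutoff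 time $2(1+\Delta)^{-1}q_nn/\hat p_n$. The same cutoff time is valid if $\mathcal G_c$ has a cutoff and $\underline\Delta_0=\overline\Delta_\infty=\Delta$. (B) The following are equivalent: 1. for every increasing sequence $\xi$, $\overline\Delta_0(\xi)<\overline\Delta_\infty(\xi)$ and $\underline\Delta_0(\xi)<\underline\Delta_\infty(\xi)$; 2. for every increasing sequence $\xi$, $\overline\Delta_0(\xi)<\overline\Delta_\infty(\xi)$ or $\underline\Delta_0(\xi)<\underline\Delta_\infty(\xi)$; 3. no subfamily of $\mathcal G_c$ (along an increasing sequence) has a cutoff. -/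

import Mathlib

open Filter Topology Asymptotics
open scoped BigOperators

noncomputable section

/-- `π` is a stationary distribution of the transition matrix `K`: a probability vector with
`π K = π`. -/
def IsStationaryDistribution {X : Type*} [Fintype X] (K : Matrix X X ℝ) (π : X → ℝ) : Prop :=
  (∀ x, 0 ≤ π x) ∧ ∑ x, π x = 1 ∧ Matrix.vecMul π K = π

/-- Detailed balance of `K` with respect to `π`. -/
def IsReversibleChain {X : Type*} (K : Matrix X X ℝ) (π : X → ℝ) : Prop :=
  ∀ x y, π x * K x y = π y * K y x

/-- The transition matrix of the product chain with weights `w`: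
`∑ i, w i • (I ⊗ ⋯ ⊗ I ⊗ K i ⊗ I ⊗ ⋯ ⊗ I)`, the factor `K i` standing at the place `i`. -/
def productKernel {ι : Type*} [Fintype ι] [DecidableEq ι] {X : ι → Type*}
    [∀ i, DecidableEq (X i)] (w : ι → ℝ) (K : ∀ i, Matrix (X i) (X i) ℝ) :
    Matrix (∀ i, X i) (∀ i, X i) ℝ :=
  fun x y => ∑ i, w i * (K i (x i) (y i) *
    ∏ j ∈ Finset.univ.erase i, (1 : Matrix (X j) (X j) ℝ) (x j) (y j))

/-- The product of the distributions `π i`. -/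
def productDistribution {ι : Type*} [Fintype ι] {X : ι → Type*} (π : ∀ i, X i → ℝ) :
    (∀ i, X i) → ℝ :=
  fun x => ∏ i, π i (x i)

/-- The transition matrix `H_t = exp (-t (I - K))` of the continuous time chain associated
with `K`. -/
def continuousKernel {X : Type*} [Fintype X] [DecidableEq X] (K : Matrix X X ℝ) (t : ℝ) :
    Matrix X X ℝ :=
  NormedSpace.exp ((-t) • (1 - K))

/-- The (maximum) total variation `sup_{x, A} (H_t(x, A) - π(A))` of the continuous time chain
associated with `(X, K, π)`. -/
def continuousTV {X : Type*} [Fintype X] [DecidableEq X] (K : Matrix X X ℝ) (π : X → ℝ)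
    (t : ℝ) : ℝ :=
  ⨆ q : X × Finset X, (∑ y ∈ q.2, continuousKernel K t q.1 y - ∑ y ∈ q.2, π y)

/-- For a sequence `d` of distance functions in continuous time (the `k`-th one being
`t ↦ d k t`), the positive sequence `t` is a cutoff time. -/
def IsCutoffTime (d : ℕ → ℝ → ℝ) (t : ℕ → ℝ) : Prop :=
  (∀ k, 0 < t k) ∧
  (∀ r : ℝ, 1 < r → Tendsto (fun k => d k (r * t k)) atTop (𝓝 0)) ∧
  (∀ r : ℝ, 0 < r → r < 1 → Tendsto (fun k => d k (r * t k)) atTop (𝓝 1))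

/-- The sequence `d` of distance functions presents a cutoff. -/
def HasCutoff (d : ℕ → ℝ → ℝ) : Prop := ∃ t, IsCutoffTime d t

/-- The transition matrix on `{0, 1, …, 2n}` of the coordinate chains. Rightward steps
`j → j + 1` have probability `1 - a` for `j ≠ n`, leftward steps `j → j - 1` (and the loop at
`0`) have probability `a`; the state `n` moves to `n + 1` with probability `b` and to `2n` with
probability `1 - a - b`; the state `2n` moves to `n` with probability `c` and stays put with
probability `1 - a - c`. For `n = 1`, where `n + 1 = 2n` and `2n - 1 = n`, the probabilities of
parallel transitions add up. -/
def lacoinKernel (n : ℕ) (a b c : ℝ) : Matrix (Fin (2 * n + 1)) (Fin (2 * n + 1)) ℝ :=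
  fun j k =>
    (if k.val = j.val + 1 ∧ j.val ≠ n then 1 - a else 0)
    + (if j.val = 0 ∧ k.val = 0 then a else 0)
    + (if j.val = k.val + 1 then a else 0)
    + (if j.val = n ∧ k.val = n + 1 then b else 0)
    + (if j.val = n ∧ k.val = 2 * n then 1 - a - b else 0)
    + (if j.val = 2 * n ∧ k.val = n then c else 0)
    + (if j.val = 2 * n ∧ k.val = 2 * n then 1 - a - c else 0)

/-- `q_n = p_{n,1} + ⋯ + p_{n,n}`. -/
def lacoinQ (p : ∀ n : ℕ, Fin n → ℝ) (n : ℕ) : ℝ := ∑ i, p n i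

/-- `p̂_n = min_i p_{n,i}`. -/
def lacoinPhat (p : ∀ n : ℕ, Fin n → ℝ) (n : ℕ) : ℝ := ⨅ i, p n i

/-- The total variation `t ↦ d_{n,TV}^{(c)}(t)` of the `n`-th chain in `𝒢_c`, where `𝒢` is the
family of products of the `n` coordinate chains according to `(p_{n,i} / q_n)_i`. -/
def lacoinTV (p a b c : ∀ n : ℕ, Fin n → ℝ) (π : ∀ n : ℕ, Fin n → Fin (2 * n + 1) → ℝ)
    (n : ℕ) (t : ℝ) : ℝ :=
  continuousTV
    (productKernel (fun i => p n i / lacoinQ p n)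
      (fun i => lacoinKernel n (a n i) (b n i) (c n i)))
    (productDistribution (π n)) t

/-- `B_n(δ)`, the sum of `b_{n,i}` over those `i` with `p_{n,i} < (1 + δ) p̂_n`. -/
def lacoinB (p b : ∀ n : ℕ, Fin n → ℝ) (n : ℕ) (δ : ℝ) : ℝ :=
  ∑ i ∈ Finset.univ.filter (fun i => p n i < (1 + δ) * lacoinPhat p n), b n i

/-- `F̄_ξ(δ) = limsup_k B_{ξ_k}(δ)`, with values in the extended reals. -/
def upperF (p b : ∀ n : ℕ, Fin n → ℝ) (ξ : ℕ → ℕ) (δ : ℝ) : EReal :=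
  limsup (fun k => ((lacoinB p b (ξ k) δ : ℝ) : EReal)) atTop

/-- `F̲_ξ(δ) = liminf_k B_{ξ_k}(δ)`, with values in the extended reals. -/
def lowerF (p b : ∀ n : ℕ, Fin n → ℝ) (ξ : ℕ → ℕ) (δ : ℝ) : EReal :=
  liminf (fun k => ((lacoinB p b (ξ k) δ : ℝ) : EReal)) atTop

/-- `sup {δ ∈ (0,1) | F δ = 0}`, with `sup ∅ = 0`. -/
def thresholdZero (F : ℝ → EReal) : ℝ :=
  sSup (insert 0 {δ : ℝ | 0 < δ ∧ δ < 1 ∧ F δ = 0})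

/-- `inf {δ ∈ (0,1) | F δ = ∞}`, with `inf ∅ = 1`. -/
def thresholdInfty (F : ℝ → EReal) : ℝ :=
  sInf (insert 1 {δ : ℝ | 0 < δ ∧ δ < 1 ∧ F δ = ⊤})

/-- An increasing sequence of positive integers. -/
def IsSubsequence (ξ : ℕ → ℕ) : Prop := StrictMono ξ ∧ ∀ k, 1 ≤ ξ k

end

/-!
Each coordinate chain has its mass at the state `2n` in the limit and is slowest to get there from
`0`. It needs about `n` steps to reach the state `n`, from where it either jumps to `2n` or, with
probability about `b`, walks the remaining `n` steps. The coordinates of the continuous time product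
chain are independent, and by the time `s q_n n / p̂_n` the `i`-th one has made about
`s n p_{n,i} / p̂_n` steps. For `s < 1` a coordinate with minimal weight has not yet arrived. For
`1 < s < 2` the coordinate `i` is missing precisely when it took the slow route and
`p_{n,i} < (2 / s) p̂_n`, so that, up to constants in the exponent, the total variation distance is
`1 - exp (-B_n(2 / s - 1))`. Hence a cutoff at `2 / (1 + Δ) · q_n n / p̂_n` means that `B_n` jumps
from `0` to `∞` at `Δ`, and the rest is a comparison of the limits of `B_n` along subsequences.
-/

/-! ### Cutoff profiles and thresholds -/

/-- The distance functions `d k`, observed at the times `s * T k`, are governed by the counting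
functions `B k`: up to `o(1)`, `d k (s * T k)` lies between `1 - exp (-B k δ / 2)` for `δ` below
`2 / s - 1` and `1 - exp (-2 * B k δ)` for `δ` above it. -/
structure IsCutoffProfile (T : ℕ → ℝ) (d B : ℕ → ℝ → ℝ) : Prop where
  scale_pos : ∀ k, 0 < T k
  antitone : ∀ k, AntitoneOn (d k) (Set.Ici 0)
  nonneg : ∀ k t, 0 ≤ t → 0 ≤ d k t
  le_one : ∀ k t, 0 ≤ t → d k t ≤ 1
  count_mono : ∀ k, Monotone (B k)
  count_nonneg : ∀ k δ, 0 ≤ B k δ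
  count_zero : ∀ k, B k 0 = 0
  early : ∀ s, 0 < s → s < 1 → Tendsto (fun k => d k (s * T k)) atTop (𝓝 1)
  upper : ∀ s δ, 1 < s → 2 < s * (1 + δ) → ∀ η > 0,
    ∀ᶠ k in atTop, d k (s * T k) ≤ 1 - Real.exp (-(2 * B k δ)) + η
  lower : ∀ s δ, 0 < s → s * (1 + δ) < 2 → ∀ η > 0,
    ∀ᶠ k in atTop, 1 - Real.exp (-(B k δ / 2)) - η ≤ d k (s * T k)

/-- `B k δ` tends to `0` for `δ` below the threshold `Δ` and to infinity above it. -/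
structure HasSharpThreshold (B : ℕ → ℝ → ℝ) (Δ : ℝ) : Prop where
  nonneg : 0 ≤ Δ
  le_one : Δ ≤ 1
  below : ∀ δ, 0 < δ → δ < Δ → Tendsto (fun k => B k δ) atTop (𝓝 0)
  above : ∀ δ, Δ < δ → δ < 1 → Tendsto (fun k => B k δ) atTop atTop

namespace IsCutoffProfile

variable {T : ℕ → ℝ} {d B : ℕ → ℝ → ℝ}

theorem comp (h : IsCutoffProfile T d B) {φ : ℕ → ℕ} (hφ : Tendsto φ atTop atTop) :
    IsCutoffProfile (fun k => T (φ k)) (fun k => d (φ k)) (fun k => B (φ k)) where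
  scale_pos _ := h.scale_pos _
  antitone _ := h.antitone _
  nonneg _ := h.nonneg _
  le_one _ := h.le_one _
  count_mono _ := h.count_mono _
  count_nonneg _ := h.count_nonneg _
  count_zero _ := h.count_zero _
  early s hs0 hs1 := (h.early s hs0 hs1).comp hφ
  upper s δ hs hδ η hη := hφ.eventually (h.upper s δ hs hδ η hη)
  lower s δ hs hδ η hη := hφ.eventually (h.lower s δ hs hδ η hη)

theorem mul_scale_nonneg (h : IsCutoffProfile T d B) {s : ℝ} (hs : 0 ≤ s) (k : ℕ) :
    0 ≤ s * T k :=
  mul_nonneg hs (h.scale_pos k).le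

theorem tendsto_zero (h : IsCutoffProfile T d B) {s δ : ℝ} (hs : 1 < s)
    (hδ : 2 < s * (1 + δ)) (hB : Tendsto (fun k => B k δ) atTop (𝓝 0)) :
    Tendsto (fun k => d k (s * T k)) atTop (𝓝 0) := by
  have hlim : Tendsto (fun k => 1 - Real.exp (-(2 * B k δ))) atTop (𝓝 0) := by
    simpa using ((hB.const_mul 2).neg.rexp).const_sub 1
  refine tendsto_order.2 ⟨fun x hx => Eventually.of_forall fun k =>
    hx.trans_le (h.nonneg k _ (h.mul_scale_nonneg (by linarith) k)), fun x hx => ?_⟩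
  filter_upwards [h.upper s δ hs hδ (x / 2) (half_pos hx),
    hlim.eventually_lt_const (half_pos hx)] with k hd hk
  linarith

theorem tendsto_one (h : IsCutoffProfile T d B) {s δ : ℝ} (hs : 0 < s)
    (hδ : s * (1 + δ) < 2) (hB : Tendsto (fun k => B k δ) atTop atTop) :
    Tendsto (fun k => d k (s * T k)) atTop (𝓝 1) := by
  have hlim : Tendsto (fun k => Real.exp (-(B k δ / 2))) atTop (𝓝 0) :=
    Real.tendsto_exp_neg_atTop_nhds_zero.comp (hB.atTop_div_const two_pos)
  refine tendsto_order.2 ⟨fun x hx => ?_, fun x hx => Eventually.of_forall fun k =>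
    (h.le_one k _ (h.mul_scale_nonneg hs.le k)).trans_lt hx⟩
  have hη : 0 < (1 - x) / 2 := by linarith
  filter_upwards [h.lower s δ hs hδ _ hη, hlim.eventually_lt_const hη] with k hd hk
  linarith

theorem tendsto_zero_of_hasSharpThreshold (h : IsCutoffProfile T d B) {Δ s : ℝ}
    (hB : HasSharpThreshold B Δ) (hs : 2 / (1 + Δ) < s) :
    Tendsto (fun k => d k (s * T k)) atTop (𝓝 0) := by
  have hΔ0 := hB.nonneg
  have hs1 : 1 < s := by
    refine lt_of_le_of_lt ?_ hs
    rw [le_div_iff₀ (by linarith)]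
    linarith [hB.le_one]
  have hs2 : 2 < s * (1 + Δ) := by rwa [div_lt_iff₀ (by linarith)] at hs
  rcases hΔ0.eq_or_lt with rfl | hΔ
  · exact h.tendsto_zero hs1 hs2 (by simp only [h.count_zero, tendsto_const_nhds])
  · have hcrit : 2 / s - 1 < Δ := by
      rw [sub_lt_iff_lt_add, div_lt_iff₀ (by linarith)]
      linarith
    obtain ⟨δ, hδ, hδΔ⟩ := exists_between (max_lt hΔ hcrit)
    obtain ⟨hδ0, hδs⟩ := max_lt_iff.1 hδ
    rw [sub_lt_iff_lt_add, div_lt_iff₀ (by linarith)] at hδs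
    exact h.tendsto_zero hs1 (by linarith) (hB.below δ hδ0 hδΔ)

theorem tendsto_one_of_hasSharpThreshold (h : IsCutoffProfile T d B) {Δ s : ℝ}
    (hB : HasSharpThreshold B Δ) (hs0 : 0 < s) (hs : s < 2 / (1 + Δ)) :
    Tendsto (fun k => d k (s * T k)) atTop (𝓝 1) := by
  rcases lt_or_ge s 1 with hs1 | hs1
  · exact h.early s hs0 hs1
  · rw [lt_div_iff₀ (by linarith [hB.nonneg])] at hs
    have hcrit : Δ < 2 / s - 1 := by
      rw [lt_sub_iff_add_lt, lt_div_iff₀ hs0]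
      linarith
    have hcrit_le : 2 / s - 1 ≤ 1 := by
      rw [sub_le_iff_le_add, div_le_iff₀ hs0]
      linarith
    obtain ⟨δ, hΔδ, hδs⟩ := exists_between hcrit
    have hδ := hB.above δ hΔδ (hδs.trans_le hcrit_le)
    rw [lt_sub_iff_add_lt, lt_div_iff₀ hs0] at hδs
    exact h.tendsto_one hs0 (by linarith) hδ

theorem isCutoffTime (h : IsCutoffProfile T d B) {Δ : ℝ} (hB : HasSharpThreshold B Δ)
    {s : ℕ → ℝ} (hs0 : ∀ k, 0 < s k) (hs : Tendsto s atTop (𝓝 (2 / (1 + Δ)))) :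
    IsCutoffTime d (fun k => s k * T k) := by
  have hcrit : 0 < 2 / (1 + Δ) := div_pos two_pos (by linarith [hB.nonneg])
  have htime : ∀ {r : ℝ}, 0 < r → ∀ k, 0 ≤ r * (s k * T k) := fun hr k =>
    mul_nonneg hr.le (mul_pos (hs0 k) (h.scale_pos k)).le
  refine ⟨fun k => mul_pos (hs0 k) (h.scale_pos k), fun r hr => ?_, fun r hr0 hr1 => ?_⟩
  · obtain ⟨s', hs', hs'r⟩ := exists_between (lt_mul_of_one_lt_left hcrit hr)
    refine tendsto_of_tendsto_of_tendsto_of_le_of_le' tendsto_const_nhds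
      (h.tendsto_zero_of_hasSharpThreshold hB hs')
      (Eventually.of_forall fun k => h.nonneg k _ (htime (by linarith) k)) ?_
    filter_upwards [(hs.const_mul r).eventually_const_lt hs'r] with k hk
    refine h.antitone k (h.mul_scale_nonneg (by linarith) k) (htime (by linarith) k) ?_
    nlinarith [h.scale_pos k]
  · obtain ⟨s', hrs', hs'⟩ := exists_between (mul_lt_of_lt_one_left hcrit hr1)
    have hs'0 : 0 < s' := (mul_pos hr0 hcrit).trans hrs'
    refine tendsto_of_tendsto_of_tendsto_of_le_of_le'
      (h.tendsto_one_of_hasSharpThreshold hB hs'0 hs') tendsto_const_nhds ?_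
      (Eventually.of_forall fun k => h.le_one k _ (htime hr0 k))
    filter_upwards [(hs.const_mul r).eventually_lt_const hrs'] with k hk
    refine h.antitone k (htime hr0 k) (h.mul_scale_nonneg hs'0.le k) ?_
    nlinarith [h.scale_pos k]

-- A cutoff time would have to lie, in units of `T`, both above `v` and below `u` for some
-- `2 / (1 + δ₂) < u < v < 2 / (1 + δ₁)`.
theorem not_hasCutoff (h : IsCutoffProfile T d B) {δ₁ δ₂ ε M : ℝ} (hδ₁ : 0 < δ₁)
    (hδ₁₂ : δ₁ < δ₂) (hδ₂ : δ₂ < 1) (hε : 0 < ε)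
    (hB : ∃ᶠ k in atTop, ε < B k δ₁ ∧ B k δ₂ < M) : ¬ HasCutoff d := by
  rintro ⟨t, ht_pos, ht_late, ht_early⟩
  obtain ⟨u, hu, huδ₁⟩ := exists_between
    (div_lt_div_of_pos_left two_pos (by linarith) (by linarith) : 2 / (1 + δ₂) < 2 / (1 + δ₁))
  obtain ⟨v, huv, hv⟩ := exists_between huδ₁
  obtain ⟨m, hum, hmv⟩ := exists_between huv
  have hu1 : 1 < u := lt_trans (by rw [lt_div_iff₀] <;> linarith) hu
  have hm : 0 < m := by linarith
  rw [div_lt_iff₀ (by linarith)] at hu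
  rw [lt_div_iff₀ (by linarith)] at hv
  have hα : 0 < (1 - Real.exp (-(ε / 2))) / 2 :=
    half_pos (sub_pos.2 (Real.exp_lt_one_iff.2 (by linarith)))
  have hβ : 0 < Real.exp (-(2 * M)) / 2 := half_pos (Real.exp_pos _)
  obtain ⟨k, ⟨hBε, hBM⟩, hupper, hlower, hlate, hearly⟩ := (hB.and_eventually
    ((h.upper u δ₂ hu1 hu _ hβ).and ((h.lower v δ₁ (by linarith) hv _ hα).and
      (((ht_late (v / m) ((one_lt_div hm).2 hmv)).eventually_lt_const hα).and
        ((ht_early (u / m) (by positivity) ((div_lt_one hm).2 hum)).eventually_const_lt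
          (sub_lt_self 1 hβ)))))).exists
  have hscaled : ∀ {w : ℝ}, 0 < w → 0 ≤ w / m * t k := fun hw =>
    mul_nonneg (by positivity) (ht_pos k).le
  rcases le_total (t k) (m * T k) with hk | hk
  · have hd : d k (v * T k) ≤ d k (v / m * t k) := by
      refine h.antitone k (hscaled (by linarith)) (h.mul_scale_nonneg (by linarith) k) ?_
      rw [div_mul_eq_mul_div, div_le_iff₀ hm]
      nlinarith
    have hexp : Real.exp (-(B k δ₁ / 2)) ≤ Real.exp (-(ε / 2)) := Real.exp_le_exp.2 (by linarith)
    linarith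
  · have hd : d k (u / m * t k) ≤ d k (u * T k) := by
      refine h.antitone k (h.mul_scale_nonneg (by linarith) k) (hscaled (by linarith)) ?_
      rw [div_mul_eq_mul_div, le_div_iff₀ hm]
      nlinarith
    have hexp : Real.exp (-(2 * M)) ≤ Real.exp (-(2 * B k δ₂)) :=
      Real.exp_le_exp.2 (by linarith)
    linarith

end IsCutoffProfile

theorem bddAbove_thresholdZero (F : ℝ → EReal) :
    BddAbove (insert 0 {δ : ℝ | 0 < δ ∧ δ < 1 ∧ F δ = 0}) :=
  BddAbove.insert 0 ⟨1, fun _ hδ => hδ.2.1.le⟩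

theorem bddBelow_insert_one (P : ℝ → Prop) :
    BddBelow (insert 1 {δ : ℝ | 0 < δ ∧ δ < 1 ∧ P δ}) :=
  BddBelow.insert 1 ⟨0, fun _ hδ => hδ.1.le⟩

theorem thresholdZero_nonneg (F : ℝ → EReal) : 0 ≤ thresholdZero F :=
  le_csSup (bddAbove_thresholdZero F) (Set.mem_insert _ _)

theorem thresholdInfty_le_one (F : ℝ → EReal) : thresholdInfty F ≤ 1 :=
  csInf_le (bddBelow_insert_one _) (Set.mem_insert _ _)

theorem le_thresholdZero {F : ℝ → EReal} {δ : ℝ} (hδ0 : 0 < δ) (hδ1 : δ < 1) (h : F δ = 0) :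
    δ ≤ thresholdZero F :=
  le_csSup (bddAbove_thresholdZero F) (Set.mem_insert_of_mem _ ⟨hδ0, hδ1, h⟩)

theorem thresholdInfty_le {F : ℝ → EReal} {δ : ℝ} (hδ0 : 0 < δ) (hδ1 : δ < 1) (h : F δ = ⊤) :
    thresholdInfty F ≤ δ :=
  csInf_le (bddBelow_insert_one _) (Set.mem_insert_of_mem _ ⟨hδ0, hδ1, h⟩)

theorem thresholdZero_le_thresholdInfty {F : ℝ → EReal} (hF : Monotone F) :
    thresholdZero F ≤ thresholdInfty F := by
  refine csSup_le (Set.insert_nonempty _ _) fun x hx =>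
    le_csInf (Set.insert_nonempty _ _) fun y hy => ?_
  rcases hx with rfl | ⟨-, hx1, hFx⟩ <;> rcases hy with rfl | ⟨hy0, -, hFy⟩
  · exact zero_le_one
  · exact hy0.le
  · exact hx1.le
  · by_contra! hyx
    simpa [hFx, hFy] using hF hyx.le

theorem eq_zero_of_lt_thresholdZero {F : ℝ → EReal} (hF : Monotone F) (hF0 : ∀ δ, 0 ≤ F δ)
    {δ : ℝ} (hδ0 : 0 < δ) (hδ : δ < thresholdZero F) : F δ = 0 := by
  obtain ⟨y, rfl | ⟨-, -, hFy⟩, hδy⟩ := exists_lt_of_lt_csSup (Set.insert_nonempty _ _) hδ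
  · exact absurd hδy hδ0.not_gt
  · exact le_antisymm (hFy ▸ hF hδy.le) (hF0 δ)

theorem eq_top_of_thresholdInfty_lt {F : ℝ → EReal} (hF : Monotone F)
    {δ : ℝ} (hδ1 : δ < 1) (hδ : thresholdInfty F < δ) : F δ = ⊤ := by
  obtain ⟨y, rfl | ⟨-, -, hFy⟩, hyδ⟩ := exists_lt_of_csInf_lt (Set.insert_nonempty _ _) hδ
  · exact absurd hyδ hδ1.not_gt
  · exact top_le_iff.1 (hFy ▸ hF hyδ.le)

theorem exists_window_of_thresholdZero_lt {F : ℝ → EReal} (hF0 : ∀ δ, 0 ≤ F δ)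
    (h : thresholdZero F < thresholdInfty F) :
    ∃ δ₁ δ₂ ε M : ℝ, 0 < δ₁ ∧ δ₁ < δ₂ ∧ δ₂ < 1 ∧ 0 < ε ∧ (ε : EReal) < F δ₁ ∧
      F δ₂ < (M : EReal) := by
  obtain ⟨δ₁, hδ₁, hδ₁'⟩ := exists_between h
  obtain ⟨δ₂, hδ₁₂, hδ₂⟩ := exists_between hδ₁'
  have hδ₁0 : 0 < δ₁ := (thresholdZero_nonneg F).trans_lt hδ₁
  have hδ₂1 : δ₂ < 1 := hδ₂.trans_le (thresholdInfty_le_one F)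
  have hpos : 0 < F δ₁ := (hF0 δ₁).lt_of_ne fun heq =>
    (le_thresholdZero hδ₁0 (hδ₁₂.trans hδ₂1) heq.symm).not_gt hδ₁
  have hfin : F δ₂ < ⊤ := lt_top_iff_ne_top.2 fun heq =>
    (thresholdInfty_le (hδ₁0.trans hδ₁₂) hδ₂1 heq).not_gt hδ₂
  obtain ⟨ε, hε0, hε⟩ := EReal.lt_iff_exists_real_btwn.1 hpos
  obtain ⟨M, hM, -⟩ := EReal.lt_iff_exists_real_btwn.1 hfin
  exact ⟨δ₁, δ₂, ε, M, hδ₁0, hδ₁₂, hδ₂1, EReal.coe_pos.1 hε0, hε, hM⟩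

/-- The pointwise upper limit of a sequence of real functions, in the extended reals. -/
noncomputable def limsupFun (B : ℕ → ℝ → ℝ) (δ : ℝ) : EReal :=
  limsup (fun k => ((B k δ : ℝ) : EReal)) atTop

/-- The pointwise lower limit of a sequence of real functions, in the extended reals. -/
noncomputable def liminfFun (B : ℕ → ℝ → ℝ) (δ : ℝ) : EReal :=
  liminf (fun k => ((B k δ : ℝ) : EReal)) atTop

section Limits

variable {B : ℕ → ℝ → ℝ}

theorem limsupFun_mono (hmono : ∀ k, Monotone (B k)) : Monotone (limsupFun B) := fun _ _ h =>
  limsup_le_limsup (Eventually.of_forall fun k => EReal.coe_le_coe_iff.2 (hmono k h))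

theorem liminfFun_mono (hmono : ∀ k, Monotone (B k)) : Monotone (liminfFun B) := fun _ _ h =>
  liminf_le_liminf (Eventually.of_forall fun k => EReal.coe_le_coe_iff.2 (hmono k h))

theorem liminfFun_nonneg (hnonneg : ∀ k δ, 0 ≤ B k δ) (δ : ℝ) : 0 ≤ liminfFun B δ :=
  le_liminf_of_le (h := Eventually.of_forall fun k => EReal.coe_nonneg.2 (hnonneg k δ))

theorem limsupFun_nonneg (hnonneg : ∀ k δ, 0 ≤ B k δ) (δ : ℝ) : 0 ≤ limsupFun B δ :=
  (liminfFun_nonneg hnonneg δ).trans liminf_le_limsup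

theorem tendsto_zero_of_limsupFun_eq_zero (hnonneg : ∀ k δ, 0 ≤ B k δ) {δ : ℝ}
    (h : limsupFun B δ = 0) : Tendsto (fun k => B k δ) atTop (𝓝 0) :=
  EReal.tendsto_coe.1 (tendsto_of_le_liminf_of_limsup_le
    (EReal.coe_zero ▸ liminfFun_nonneg hnonneg δ) (EReal.coe_zero ▸ h.le))

theorem tendsto_atTop_of_liminfFun_eq_top {δ : ℝ} (h : liminfFun B δ = ⊤) :
    Tendsto (fun k => B k δ) atTop atTop :=
  EReal.tendsto_coe_nhds_top_iff.1 (tendsto_of_le_liminf_of_limsup_le h.ge le_top)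

theorem tendsto_zero_of_lt_thresholdZero (hmono : ∀ k, Monotone (B k))
    (hnonneg : ∀ k δ, 0 ≤ B k δ) {δ : ℝ} (hδ0 : 0 < δ) (hδ : δ < thresholdZero (limsupFun B)) :
    Tendsto (fun k => B k δ) atTop (𝓝 0) :=
  tendsto_zero_of_limsupFun_eq_zero hnonneg (eq_zero_of_lt_thresholdZero (limsupFun_mono hmono)
    (limsupFun_nonneg hnonneg) hδ0 hδ)

theorem tendsto_atTop_of_thresholdInfty_lt (hmono : ∀ k, Monotone (B k)) {δ : ℝ}
    (hδ : thresholdInfty (liminfFun B) < δ) (hδ1 : δ < 1) :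
    Tendsto (fun k => B k δ) atTop atTop :=
  tendsto_atTop_of_liminfFun_eq_top
    (eq_top_of_thresholdInfty_lt (liminfFun_mono hmono) hδ1 hδ)

theorem hasSharpThreshold_of_outer (hmono : ∀ k, Monotone (B k)) (hnonneg : ∀ k δ, 0 ≤ B k δ)
    {Δ : ℝ} (hzero : thresholdZero (limsupFun B) = Δ)
    (hinfty : thresholdInfty (liminfFun B) = Δ) : HasSharpThreshold B Δ where
  nonneg := hzero ▸ thresholdZero_nonneg _
  le_one := hinfty ▸ thresholdInfty_le_one _
  below _ hδ0 hδ := tendsto_zero_of_lt_thresholdZero hmono hnonneg hδ0 (hzero ▸ hδ)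
  above _ hδ hδ1 := tendsto_atTop_of_thresholdInfty_lt hmono (hinfty ▸ hδ) hδ1

theorem exists_hasSharpThreshold_of_limsup (hmono : ∀ k, Monotone (B k))
    (hnonneg : ∀ k δ, 0 ≤ B k δ)
    (h : thresholdZero (limsupFun B) = thresholdInfty (limsupFun B)) :
    ∃ φ : ℕ → ℕ, StrictMono φ ∧ ∃ Δ, HasSharpThreshold (fun k => B (φ k)) Δ := by
  set Δ := thresholdInfty (limsupFun B)
  have hΔ0 : 0 ≤ Δ := h ▸ thresholdZero_nonneg _
  have hΔ1 : Δ ≤ 1 := thresholdInfty_le_one _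
  have hbelow : ∀ δ, 0 < δ → δ < Δ → Tendsto (fun k => B k δ) atTop (𝓝 0) := fun δ hδ0 hδ =>
    tendsto_zero_of_lt_thresholdZero hmono hnonneg hδ0 (h ▸ hδ)
  rcases hΔ1.eq_or_lt with hΔ | hΔ
  · exact ⟨id, strictMono_id, Δ, hΔ0, hΔ1, hbelow, fun δ hδ hδ1 => by linarith⟩
  obtain ⟨u, -, hu_mem, hu_lim⟩ := exists_seq_strictAnti_tendsto' hΔ
  have hfreq : ∀ m : ℕ, ∃ᶠ k in atTop, (m : ℝ) < B k (u m) := fun m => by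
    have htop : limsupFun B (u m) = ⊤ :=
      eq_top_of_thresholdInfty_lt (limsupFun_mono hmono) (hu_mem m).2 (hu_mem m).1
    have hlt : ((m : ℝ) : EReal) < limsupFun B (u m) := htop ▸ EReal.coe_lt_top _
    exact (frequently_lt_of_lt_limsup (h := hlt)).mono fun k hk => EReal.coe_lt_coe_iff.1 hk
  obtain ⟨φ, hφ, hBφ⟩ := extraction_forall_of_frequently hfreq
  refine ⟨φ, hφ, Δ, hΔ0, hΔ1, fun δ hδ0 hδ => (hbelow δ hδ0 hδ).comp hφ.tendsto_atTop,
    fun δ hδ _ => tendsto_atTop_mono' _ ?_ tendsto_natCast_atTop_atTop⟩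
  filter_upwards [hu_lim.eventually_lt_const hδ] with m hm
  exact (hBφ m).le.trans (hmono _ hm.le)

theorem exists_hasSharpThreshold_of_liminf (hmono : ∀ k, Monotone (B k))
    (hnonneg : ∀ k δ, 0 ≤ B k δ)
    (h : thresholdZero (liminfFun B) = thresholdInfty (liminfFun B)) :
    ∃ φ : ℕ → ℕ, StrictMono φ ∧ ∃ Δ, HasSharpThreshold (fun k => B (φ k)) Δ := by
  set Δ := thresholdInfty (liminfFun B)
  have hΔ0 : 0 ≤ Δ := h ▸ thresholdZero_nonneg _
  have hΔ1 : Δ ≤ 1 := thresholdInfty_le_one _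
  have habove : ∀ δ, Δ < δ → δ < 1 → Tendsto (fun k => B k δ) atTop atTop := fun δ hδ hδ1 =>
    tendsto_atTop_of_thresholdInfty_lt hmono hδ hδ1
  rcases hΔ0.eq_or_lt with hΔ | hΔ
  · exact ⟨id, strictMono_id, Δ, hΔ0, hΔ1, fun δ hδ0 hδ => by linarith, habove⟩
  obtain ⟨u, -, hu_mem, hu_lim⟩ := exists_seq_strictMono_tendsto' hΔ
  have hfreq : ∀ m : ℕ, ∃ᶠ k in atTop, B k (u m) < 1 / ((m : ℝ) + 1) := fun m => by
    have hzero : liminfFun B (u m) = 0 :=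
      eq_zero_of_lt_thresholdZero (liminfFun_mono hmono) (liminfFun_nonneg hnonneg)
        (hu_mem m).1 (h ▸ (hu_mem m).2)
    have hlt : liminfFun B (u m) < ((1 / ((m : ℝ) + 1) : ℝ) : EReal) :=
      hzero ▸ EReal.coe_pos.2 Nat.one_div_pos_of_nat
    exact (frequently_lt_of_liminf_lt (h := hlt)).mono fun k hk => EReal.coe_lt_coe_iff.1 hk
  obtain ⟨φ, hφ, hBφ⟩ := extraction_forall_of_frequently hfreq
  refine ⟨φ, hφ, Δ, hΔ0, hΔ1, fun δ _ hδ => ?_,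
    fun δ hδ hδ1 => (habove δ hδ hδ1).comp hφ.tendsto_atTop⟩
  refine tendsto_of_tendsto_of_tendsto_of_le_of_le' tendsto_const_nhds
    tendsto_one_div_add_atTop_nhds_zero_nat (Eventually.of_forall fun m => hnonneg _ _) ?_
  filter_upwards [hu_lim.eventually_const_lt hδ] with m hm
  exact (hmono _ hm.le).trans (hBφ m).le

end Limits

/-- The first level in `(0, 1)` at which the counting function `b` reaches `1`, or `1` if there is
none. -/
noncomputable def crossingLevel (b : ℝ → ℝ) : ℝ :=
  sInf (insert 1 {δ : ℝ | 0 < δ ∧ δ < 1 ∧ 1 ≤ b δ})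

theorem crossingLevel_nonneg (b : ℝ → ℝ) : 0 ≤ crossingLevel b := by
  refine le_csInf (Set.insert_nonempty _ _) ?_
  rintro y (rfl | hy)
  exacts [zero_le_one, hy.1.le]

theorem crossingLevel_le_one (b : ℝ → ℝ) : crossingLevel b ≤ 1 :=
  csInf_le (bddBelow_insert_one _) (Set.mem_insert _ _)

theorem HasSharpThreshold.tendsto_crossingLevel {B : ℕ → ℝ → ℝ} {Δ : ℝ}
    (h : HasSharpThreshold B Δ) (hmono : ∀ k, Monotone (B k)) :
    Tendsto (fun k => crossingLevel (B k)) atTop (𝓝 Δ) := by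
  refine tendsto_order.2 ⟨fun x hx => ?_, fun x hx => ?_⟩
  · rcases lt_or_ge x 0 with hx0 | hx0
    · exact Eventually.of_forall fun k => hx0.trans_le (crossingLevel_nonneg _)
    obtain ⟨y, hxy, hy⟩ := exists_between hx
    filter_upwards [(h.below y (by linarith) hy).eventually_lt_const one_pos] with k hk
    refine hxy.trans_le (le_csInf (Set.insert_nonempty _ _) ?_)
    rintro w (rfl | ⟨-, -, hw⟩)
    · exact hy.le.trans h.le_one
    · exact ((hmono k).reflect_lt (hk.trans_le hw)).le
  · rcases lt_or_ge 1 x with hx1 | hx1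
    · exact Eventually.of_forall fun k => (crossingLevel_le_one _).trans_lt hx1
    obtain ⟨y, hy, hyx⟩ := exists_between hx
    filter_upwards [(h.above y hy (by linarith)).eventually_ge_atTop 1] with k hk
    exact (csInf_le (bddBelow_insert_one _) (Set.mem_insert_of_mem _
      ⟨h.nonneg.trans_lt hy, by linarith, hk⟩)).trans_lt hyx

theorem tendsto_two_div_one_add {α : Type*} {l : Filter α} {x : α → ℝ} {Δ : ℝ}
    (hΔ : 0 ≤ Δ) (hx : Tendsto x l (𝓝 Δ)) :
    Tendsto (fun k => 2 / (1 + x k)) l (𝓝 (2 / (1 + Δ))) :=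
  tendsto_const_nhds.div (hx.const_add 1) (by linarith)

namespace IsCutoffProfile

variable {T : ℕ → ℝ} {d B : ℕ → ℝ → ℝ}

theorem thresholds_eq_of_hasCutoff (h : IsCutoffProfile T d B) (hcut : HasCutoff d) :
    thresholdZero (limsupFun B) = thresholdInfty (limsupFun B) ∧
      thresholdZero (liminfFun B) = thresholdInfty (liminfFun B) := by
  constructor
  · refine (thresholdZero_le_thresholdInfty (limsupFun_mono h.count_mono)).eq_of_not_lt
      fun hlt => ?_
    obtain ⟨δ₁, δ₂, ε, M, hδ₁, hδ₁₂, hδ₂, hε, hεF, hFM⟩ :=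
      exists_window_of_thresholdZero_lt (limsupFun_nonneg h.count_nonneg) hlt
    refine h.not_hasCutoff hδ₁ hδ₁₂ hδ₂ hε (M := M) (((frequently_lt_of_lt_limsup
      (h := hεF)).and_eventually
      (eventually_lt_of_limsup_lt (h := hFM))).mono fun k hk => ?_) hcut
    exact ⟨EReal.coe_lt_coe_iff.1 hk.1, EReal.coe_lt_coe_iff.1 hk.2⟩
  · refine (thresholdZero_le_thresholdInfty (liminfFun_mono h.count_mono)).eq_of_not_lt
      fun hlt => ?_
    obtain ⟨δ₁, δ₂, ε, M, hδ₁, hδ₁₂, hδ₂, hε, hεF, hFM⟩ :=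
      exists_window_of_thresholdZero_lt (liminfFun_nonneg h.count_nonneg) hlt
    refine h.not_hasCutoff hδ₁ hδ₁₂ hδ₂ hε (M := M) (((frequently_lt_of_liminf_lt
      (h := hFM)).and_eventually
      (eventually_lt_of_lt_liminf (h := hεF))).mono fun k hk => ?_) hcut
    exact ⟨EReal.coe_lt_coe_iff.1 hk.2, EReal.coe_lt_coe_iff.1 hk.1⟩

theorem exists_hasSharpThreshold (h : IsCutoffProfile T d B)
    (heq : thresholdZero (limsupFun B) = thresholdInfty (limsupFun B) ∨
      thresholdZero (liminfFun B) = thresholdInfty (liminfFun B)) :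
    ∃ φ : ℕ → ℕ, StrictMono φ ∧ ∃ Δ, HasSharpThreshold (fun k => B (φ k)) Δ :=
  heq.elim (exists_hasSharpThreshold_of_limsup h.count_mono h.count_nonneg)
    (exists_hasSharpThreshold_of_liminf h.count_mono h.count_nonneg)

theorem isCutoffTime_of_outer (h : IsCutoffProfile T d B) {Δ : ℝ}
    (hzero : thresholdZero (limsupFun B) = Δ) (hinfty : thresholdInfty (liminfFun B) = Δ) :
    IsCutoffTime d (fun k => 2 * (1 + Δ)⁻¹ * T k) := by
  have hB := hasSharpThreshold_of_outer h.count_mono h.count_nonneg hzero hinfty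
  rw [← div_eq_mul_inv]
  exact h.isCutoffTime hB (fun _ => div_pos two_pos (by linarith [hB.nonneg])) tendsto_const_nhds

theorem isCutoffTime_crossingLevel (h : IsCutoffProfile T d B) {Δ : ℝ}
    (hB : HasSharpThreshold B Δ) :
    IsCutoffTime d (fun k => 2 / (1 + crossingLevel (B k)) * T k) :=
  h.isCutoffTime hB (fun k => div_pos two_pos (by linarith [crossingLevel_nonneg (B k)]))
    (tendsto_two_div_one_add hB.nonneg (hB.tendsto_crossingLevel h.count_mono))

theorem exists_subseq_hasCutoff (h : IsCutoffProfile T d B)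
    (heq : thresholdZero (limsupFun B) = thresholdInfty (limsupFun B) ∨
      thresholdZero (liminfFun B) = thresholdInfty (liminfFun B)) :
    ∃ φ : ℕ → ℕ, StrictMono φ ∧ HasCutoff (fun k => d (φ k)) := by
  obtain ⟨φ, hφ, Δ, hB⟩ := h.exists_hasSharpThreshold heq
  exact ⟨φ, hφ, _, (h.comp hφ.tendsto_atTop).isCutoffTime_crossingLevel hB⟩

theorem thresholds_lt_of_forall_subseq (h : IsCutoffProfile T d B)
    (hno : ∀ φ : ℕ → ℕ, StrictMono φ → ¬ HasCutoff (fun k => d (φ k))) :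
    thresholdZero (limsupFun B) < thresholdInfty (limsupFun B) ∧
      thresholdZero (liminfFun B) < thresholdInfty (liminfFun B) := by
  have hne := mt h.exists_subseq_hasCutoff fun ⟨φ, hφ, hcut⟩ => hno φ hφ hcut
  rw [not_or] at hne
  exact ⟨(thresholdZero_le_thresholdInfty (limsupFun_mono h.count_mono)).lt_of_ne hne.1,
    (thresholdZero_le_thresholdInfty (liminfFun_mono h.count_mono)).lt_of_ne hne.2⟩

-- The crossing levels give one candidate for the cutoff time that works along all subsequences.
theorem hasCutoff_of_forall_subseq (h : IsCutoffProfile T d B)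
    (hsub : ∀ φ : ℕ → ℕ, StrictMono φ →
      thresholdZero (limsupFun fun k => B (φ k)) = thresholdInfty (limsupFun fun k => B (φ k)) ∨
      thresholdZero (liminfFun fun k => B (φ k)) = thresholdInfty (liminfFun fun k => B (φ k))) :
    HasCutoff d := by
  have hext : ∀ ns : ℕ → ℕ, Tendsto ns atTop atTop → ∃ ms : ℕ → ℕ,
      IsCutoffTime (fun k => d (ns (ms k)))
        (fun k => 2 / (1 + crossingLevel (B (ns (ms k)))) * T (ns (ms k))) := fun ns hns => by
    obtain ⟨φ, -, hφ⟩ := strictMono_subseq_of_tendsto_atTop hns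
    obtain ⟨ψ, hψ, Δ, hB⟩ := (h.comp hφ.tendsto_atTop).exists_hasSharpThreshold (hsub _ hφ)
    exact ⟨fun k => φ (ψ k), (h.comp (φ := fun k => ns (φ (ψ k)))
      (hφ.tendsto_atTop.comp hψ.tendsto_atTop)).isCutoffTime_crossingLevel hB⟩
  refine ⟨fun k => 2 / (1 + crossingLevel (B k)) * T k,
    fun k => mul_pos (div_pos two_pos (by linarith [crossingLevel_nonneg (B k)])) (h.scale_pos k),
    fun r hr => tendsto_of_subseq_tendsto fun ns hns => ?_,
    fun r hr0 hr1 => tendsto_of_subseq_tendsto fun ns hns => ?_⟩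
  · obtain ⟨ms, hms⟩ := hext ns hns
    exact ⟨ms, hms.2.1 r hr⟩
  · obtain ⟨ms, hms⟩ := hext ns hns
    exact ⟨ms, hms.2.2 r hr0 hr1⟩

end IsCutoffProfile

theorem IsSubsequence.comp {ξ φ : ℕ → ℕ} (hξ : IsSubsequence ξ) (hφ : StrictMono φ) :
    IsSubsequence fun k => ξ (φ k) :=
  ⟨hξ.1.comp hφ, fun k => hξ.2 (φ k)⟩

theorem isSubsequence_succ : IsSubsequence fun k => k + 1 :=
  ⟨fun _ _ h => Nat.succ_lt_succ h, fun _ => Nat.succ_pos _⟩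

theorem HasCutoff.of_isSubsequence {d : ℕ → ℝ → ℝ} (h : HasCutoff fun k => d (k + 1))
    {ξ : ℕ → ℕ} (hξ : IsSubsequence ξ) : HasCutoff fun k => d (ξ k) := by
  obtain ⟨t, ht_pos, ht_late, ht_early⟩ := h
  have hlim : Tendsto (fun k => ξ k - 1) atTop atTop :=
    (tendsto_sub_atTop_nat 1).comp hξ.1.tendsto_atTop
  have hpred : ∀ k, ξ k - 1 + 1 = ξ k := fun k => Nat.sub_add_cancel (hξ.2 k)
  refine ⟨fun k => t (ξ k - 1), fun k => ht_pos _, fun r hr => ?_, fun r hr0 hr1 => ?_⟩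
  · simpa only [Function.comp_def, hpred] using (ht_late r hr).comp hlim
  · simpa only [Function.comp_def, hpred] using (ht_early r hr0 hr1).comp hlim

/-! ### Continuous time chains and their products -/

/-- The probability that a Poisson variable of mean `t` takes the value `m`. -/
noncomputable def poissonWeight (t : ℝ) (m : ℕ) : ℝ := Real.exp (-t) * (t ^ m / m.factorial)

theorem poissonWeight_nonneg {t : ℝ} (ht : 0 ≤ t) (m : ℕ) : 0 ≤ poissonWeight t m := by
  unfold poissonWeight
  positivity

theorem hasSum_poissonWeight_mul_pow (t r : ℝ) :
    HasSum (fun m => poissonWeight t m * r ^ m) (Real.exp (-(t * (1 - r)))) := by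
  have h := (NormedSpace.expSeries_div_hasSum_exp (t * r)).mul_left (Real.exp (-t))
  rw [← Real.exp_eq_exp_ℝ, ← Real.exp_add] at h
  convert! h using 1
  · ext m
    rw [poissonWeight, mul_pow]
    ring
  · congr 1
    ring

theorem hasSum_poissonWeight (t : ℝ) : HasSum (poissonWeight t) 1 := by
  simpa using hasSum_poissonWeight_mul_pow t 1

-- Chernoff's bound: `ρ ^ m * (1 - exp (θ * (N - m)))` is a lower bound for `f m` for every `m`,
-- and its Poisson mean is explicit.
theorem le_of_hasSum_poissonWeight_mul {f : ℕ → ℝ} {A N α ρ θ t : ℝ}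
    (hA : HasSum (fun m => poissonWeight t m * f m) A) (ht : 0 ≤ t) (hα : 0 ≤ α) (hρ0 : 0 ≤ ρ)
    (hρ1 : ρ ≤ 1) (hf0 : ∀ m, 0 ≤ f m) (hf : ∀ m : ℕ, 0 ≤ θ * (m - N) → α * ρ ^ m ≤ f m) :
    α * (Real.exp (-(t * (1 - ρ))) - Real.exp (N * θ - t * (1 - Real.exp (-θ)))) ≤ A := by
  have hpow : ∀ m : ℕ, α * ρ ^ m - α * Real.exp (N * θ) * (ρ * Real.exp (-θ)) ^ m ≤ f m := by
    intro m
    have hfactor : α * ρ ^ m - α * Real.exp (N * θ) * (ρ * Real.exp (-θ)) ^ m =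
        α * ρ ^ m * (1 - Real.exp (-(θ * (m - N)))) := by
      rw [mul_pow, ← Real.exp_nat_mul, show -(θ * (m - N)) = N * θ + m * -θ by ring,
        Real.exp_add]
      ring
    have hαρ : 0 ≤ α * ρ ^ m := by positivity
    rw [hfactor]
    rcases le_or_gt 0 (θ * (m - N)) with hm | hm
    · exact (mul_le_of_le_one_right hαρ (by linarith [Real.exp_pos (-(θ * (m - N)))])).trans
        (hf m hm)
    · refine (mul_nonpos_of_nonneg_of_nonpos hαρ (sub_nonpos.2 (Real.one_le_exp ?_))).trans
        (hf0 m)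
      linarith
  have hmean := hasSum_le (fun m => ?_) (((hasSum_poissonWeight_mul_pow t ρ).mul_left α).sub
    ((hasSum_poissonWeight_mul_pow t (ρ * Real.exp (-θ))).mul_left (α * Real.exp (N * θ)))) hA
  · have hexp : Real.exp (N * θ) * Real.exp (-(t * (1 - ρ * Real.exp (-θ)))) ≤
        Real.exp (N * θ - t * (1 - Real.exp (-θ))) := by
      rw [← Real.exp_add, Real.exp_le_exp]
      nlinarith [mul_le_mul_of_nonneg_left (mul_le_of_le_one_left (Real.exp_pos (-θ)).le hρ1) ht]
    nlinarith [mul_le_mul_of_nonneg_left hexp hα]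
  · calc _ = poissonWeight t m *
          (α * ρ ^ m - α * Real.exp (N * θ) * (ρ * Real.exp (-θ)) ^ m) := by ring
      _ ≤ _ := mul_le_mul_of_nonneg_left (hpow m) (poissonWeight_nonneg ht m)

section GeneralChains

variable {X : Type*} [Fintype X] [DecidableEq X] {K : Matrix X X ℝ} {π : X → ℝ}

theorem continuousKernel_add (K : Matrix X X ℝ) (s t : ℝ) :
    continuousKernel K (s + t) = continuousKernel K s * continuousKernel K t := by
  unfold continuousKernel
  rw [← Matrix.exp_add_of_commute _ _ (((Commute.refl _).smul_left _).smul_right _), ← add_smul,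
    neg_add]

theorem continuousKernel_eq_smul_exp (K : Matrix X X ℝ) (t : ℝ) :
    continuousKernel K t = Real.exp (-t) • NormedSpace.exp (t • K) := by
  let _ : NormedRing (Matrix X X ℝ) := Matrix.linftyOpNormedRing
  let _ : NormedAlgebra ℝ (Matrix X X ℝ) := Matrix.linftyOpNormedAlgebra
  have hscalar : NormedSpace.exp (algebraMap ℝ (Matrix X X ℝ) (-t)) =
      algebraMap ℝ _ (Real.exp (-t)) := by
    rw [Real.exp_eq_exp_ℝ]
    exact (NormedSpace.algebraMap_exp_comm (-t)).symm
  have hsplit : (-t) • (1 - K) = algebraMap ℝ (Matrix X X ℝ) (-t) + t • K := by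
    rw [Algebra.algebraMap_eq_smul_one, smul_sub, neg_smul t K, sub_neg_eq_add]
  rw [continuousKernel, hsplit, Matrix.exp_add_of_commute _ _ (Algebra.commute_algebraMap_left _ _),
    hscalar, ← Algebra.smul_def]

theorem hasSum_continuousKernel (K : Matrix X X ℝ) (t : ℝ) (x y : X) :
    HasSum (fun m => poissonWeight t m * (K ^ m) x y) (continuousKernel K t x y) := by
  have hseries : HasSum (fun m : ℕ => ((m.factorial : ℝ)⁻¹) • (t • K) ^ m)
      (NormedSpace.exp (t • K)) := by
    let _ : NormedRing (Matrix X X ℝ) := Matrix.linftyOpNormedRing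
    let _ : NormedAlgebra ℝ (Matrix X X ℝ) := Matrix.linftyOpNormedAlgebra
    exact NormedSpace.exp_series_hasSum_exp' (𝕂 := ℝ) (t • K)
  have hentry := (Pi.hasSum.1 (Pi.hasSum.1 hseries x) y).mul_left (Real.exp (-t))
  rw [continuousKernel_eq_smul_exp, Matrix.smul_apply, smul_eq_mul]
  refine hentry.congr_fun fun m => ?_
  simp only [poissonWeight, Matrix.smul_apply, smul_pow, smul_eq_mul]
  ring

theorem hasSum_one_sub_continuousKernel (K : Matrix X X ℝ) (t : ℝ) (x y : X) :
    HasSum (fun m => poissonWeight t m * (1 - (K ^ m) x y)) (1 - continuousKernel K t x y) := by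
  simpa only [mul_sub, mul_one] using (hasSum_poissonWeight t).sub (hasSum_continuousKernel K t x y)

theorem continuousKernel_mem_rowStochastic (hK : K ∈ Matrix.rowStochastic ℝ X) {t : ℝ}
    (ht : 0 ≤ t) : continuousKernel K t ∈ Matrix.rowStochastic ℝ X := by
  refine Matrix.mem_rowStochastic_iff_sum.2 ⟨fun x y => ?_, fun x => ?_⟩
  · exact (hasSum_continuousKernel K t x y).nonneg fun m =>
      mul_nonneg (poissonWeight_nonneg ht m) (Matrix.nonneg_of_mem_rowStochastic (pow_mem hK m))
  · have hrow := hasSum_sum fun y (_ : y ∈ Finset.univ) => hasSum_continuousKernel K t x y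
    simp_rw [← Finset.mul_sum, Matrix.sum_row_of_mem_rowStochastic (pow_mem hK _) x,
      mul_one] at hrow
    exact hrow.unique (hasSum_poissonWeight t)

theorem IsStationaryDistribution.vecMul_pow (h : IsStationaryDistribution K π) (m : ℕ) :
    Matrix.vecMul π (K ^ m) = π := by
  induction m with
  | zero => simp
  | succ m ih => rw [pow_succ, ← Matrix.vecMul_vecMul, ih, h.2.2]

theorem IsStationaryDistribution.sum_mul_continuousKernel (h : IsStationaryDistribution K π)
    (t : ℝ) (z : X) : ∑ x, π x * continuousKernel K t x z = π z := by
  refine (hasSum_sum fun x (_ : x ∈ Finset.univ) =>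
    (hasSum_continuousKernel K t x z).mul_left (π x)).unique ?_
  have hπ := (hasSum_poissonWeight t).mul_right (π z)
  rw [one_mul] at hπ
  refine hπ.congr_fun fun m => ?_
  rw [← congrFun (h.vecMul_pow m) z, Matrix.vecMul, dotProduct, Finset.mul_sum]
  exact Finset.sum_congr rfl fun x _ => mul_left_comm _ _ _

theorem IsStationaryDistribution.le_apply_of_le_continuousKernel
    (h : IsStationaryDistribution K π) {t β : ℝ} {z : X}
    (hβ : ∀ x, β ≤ continuousKernel K t x z) : β ≤ π z := by
  rw [← h.sum_mul_continuousKernel t z, ← one_mul β, ← h.2.1, Finset.sum_mul]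
  exact Finset.sum_le_sum fun x _ => mul_le_mul_of_nonneg_left (hβ x) (h.1 x)

theorem le_continuousKernel_of_le (hK : K ∈ Matrix.rowStochastic ℝ X) {s t β : ℝ} (hst : s ≤ t)
    {z : X} (hβ : ∀ x, β ≤ continuousKernel K s x z) (x : X) : β ≤ continuousKernel K t x z := by
  have hrow := continuousKernel_mem_rowStochastic hK (sub_nonneg.2 hst)
  rw [← sub_add_cancel t s, continuousKernel_add, Matrix.mul_apply, ← one_mul β,
    ← Matrix.sum_row_of_mem_rowStochastic hrow x, Finset.sum_mul]
  exact Finset.sum_le_sum fun y _ =>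
    mul_le_mul_of_nonneg_left (hβ y) (Matrix.nonneg_of_mem_rowStochastic hrow)

theorem sum_continuousKernel_le_one (hK : K ∈ Matrix.rowStochastic ℝ X) {t : ℝ} (ht : 0 ≤ t)
    (x : X) (A : Finset X) : ∑ y ∈ A, continuousKernel K t x y ≤ 1 := by
  have hrow := continuousKernel_mem_rowStochastic hK ht
  exact Matrix.sum_row_of_mem_rowStochastic hrow x ▸
    Finset.sum_le_univ_sum_of_nonneg fun y => Matrix.nonneg_of_mem_rowStochastic hrow

theorem le_continuousTV (K : Matrix X X ℝ) (π : X → ℝ) (t : ℝ) (x : X) (A : Finset X) :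
    ∑ y ∈ A, continuousKernel K t x y - ∑ y ∈ A, π y ≤ continuousTV K π t :=
  le_ciSup (f := fun q : X × Finset X =>
    ∑ y ∈ q.2, continuousKernel K t q.1 y - ∑ y ∈ q.2, π y) (Set.finite_range _).bddAbove (x, A)

theorem continuousTV_nonneg [Nonempty X] (K : Matrix X X ℝ) (π : X → ℝ) (t : ℝ) :
    0 ≤ continuousTV K π t := by
  simpa using le_continuousTV K π t (Classical.arbitrary X) ∅

theorem continuousTV_le_one [Nonempty X] (hK : K ∈ Matrix.rowStochastic ℝ X) (hπ : ∀ x, 0 ≤ π x)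
    {t : ℝ} (ht : 0 ≤ t) : continuousTV K π t ≤ 1 :=
  ciSup_le fun q => (sub_le_self _ (Finset.sum_nonneg fun y _ => hπ y)).trans
    (sum_continuousKernel_le_one hK ht q.1 q.2)

theorem continuousTV_antitone [Nonempty X] (hK : K ∈ Matrix.rowStochastic ℝ X) :
    Antitone (continuousTV K π) := by
  refine fun s t hst => ciSup_le fun ⟨x, A⟩ => ?_
  have hrow := continuousKernel_mem_rowStochastic hK (sub_nonneg.2 hst)
  have hsum := Matrix.sum_row_of_mem_rowStochastic hrow x
  calc ∑ y ∈ A, continuousKernel K t x y - ∑ y ∈ A, π y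
      = ∑ z, continuousKernel K (t - s) x z * ∑ y ∈ A, continuousKernel K s z y
          - ∑ y ∈ A, π y := by
        rw [← sub_add_cancel t s, continuousKernel_add, sub_add_cancel]
        simp_rw [Matrix.mul_apply, Finset.mul_sum]
        rw [Finset.sum_comm]
    _ = ∑ z, continuousKernel K (t - s) x z *
          (∑ y ∈ A, continuousKernel K s z y - ∑ y ∈ A, π y) := by
        simp_rw [mul_sub, Finset.sum_sub_distrib, ← Finset.sum_mul, hsum, one_mul]
    _ ≤ ∑ z, continuousKernel K (t - s) x z * continuousTV K π s :=
        Finset.sum_le_sum fun z _ => mul_le_mul_of_nonneg_left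
          (le_continuousTV K π s z A) (Matrix.nonneg_of_mem_rowStochastic hrow)
    _ = continuousTV K π s := by rw [← Finset.sum_mul, hsum, one_mul]

theorem continuousTV_le_one_sub [Nonempty X] (hK : K ∈ Matrix.rowStochastic ℝ X)
    (hπ : ∀ x, 0 ≤ π x) {t β : ℝ} (ht : 0 ≤ t) {z : X} (hz : β ≤ π z)
    (hβ : ∀ x, β ≤ continuousKernel K t x z) : continuousTV K π t ≤ 1 - β := by
  refine ciSup_le fun ⟨x, A⟩ => ?_
  by_cases hzA : z ∈ A
  · linarith [sum_continuousKernel_le_one hK ht x A,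
      Finset.single_le_sum (fun y _ => hπ y) hzA]
  · have hle := sum_continuousKernel_le_one hK ht x (insert z A)
    rw [Finset.sum_insert hzA] at hle
    linarith [hβ x, Finset.sum_nonneg fun y (_ : y ∈ A) => hπ y]

theorem sub_le_continuousTV (hK : K ∈ Matrix.rowStochastic ℝ X) (hπ : ∑ x, π x = 1) {t : ℝ}
    (ht : 0 ≤ t) (x z : X) : π z - continuousKernel K t x z ≤ continuousTV K π t := by
  have hle := le_continuousTV K π t x (Finset.univ.erase z)
  rw [Finset.sum_erase_eq_sub (Finset.mem_univ z), Finset.sum_erase_eq_sub (Finset.mem_univ z), hπ,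
    Matrix.sum_row_of_mem_rowStochastic (continuousKernel_mem_rowStochastic hK ht) x] at hle
  linarith

end GeneralChains

section ProductChains

variable {ι : Type*} [Fintype ι] {X : ι → Type*}

/-- The tensor product `⨂ i, M i`, as a matrix over the product of the index sets. -/
def tensorMatrix (M : ∀ i, Matrix (X i) (X i) ℝ) :
    Matrix (∀ i, X i) (∀ i, X i) ℝ :=
  fun x y => ∏ i, M i (x i) (y i)

theorem productDistribution_nonneg {π : ∀ i, X i → ℝ} (h : ∀ i x, 0 ≤ π i x)
    (x : ∀ i, X i) : 0 ≤ productDistribution π x :=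
  Finset.prod_nonneg fun i _ => h i _

theorem tensorMatrix_one [∀ i, DecidableEq (X i)] :
    tensorMatrix (1 : ∀ i, Matrix (X i) (X i) ℝ) = 1 := by
  ext x y
  rcases eq_or_ne x y with rfl | h
  · simp [tensorMatrix]
  · obtain ⟨i, hi⟩ := Function.ne_iff.1 h
    rw [Matrix.one_apply_ne h]
    exact Finset.prod_eq_zero (Finset.mem_univ i) (Matrix.one_apply_ne hi)

variable [DecidableEq ι]

theorem tensorMatrix_update (M : ∀ i, Matrix (X i) (X i) ℝ) (i : ι) (A : Matrix (X i) (X i) ℝ)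
    (x y : ∀ i, X i) :
    tensorMatrix (Function.update M i A) x y =
      A (x i) (y i) * ∏ j ∈ Finset.univ.erase i, M j (x j) (y j) := by
  rw [tensorMatrix, ← Finset.mul_prod_erase _ _ (Finset.mem_univ i), Function.update_self]
  congr 1
  exact Finset.prod_congr rfl fun j hj => by rw [Function.update_of_ne (Finset.ne_of_mem_erase hj)]

variable [∀ i, Fintype (X i)]

theorem sum_prod_apply_eq_one {f : ∀ i, X i → ℝ} (h : ∀ i, ∑ x, f i x = 1) :
    ∑ x : ∀ i, X i, ∏ i, f i (x i) = 1 := by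
  rw [← Fintype.piFinset_univ, ← Finset.prod_univ_sum]
  exact Finset.prod_eq_one fun i _ => h i

theorem tensorMatrix_mul (M N : ∀ i, Matrix (X i) (X i) ℝ) :
    tensorMatrix M * tensorMatrix N = tensorMatrix (M * N) := by
  ext x y
  simp only [tensorMatrix, Matrix.mul_apply, Pi.mul_apply, Finset.prod_univ_sum,
    ← Finset.prod_mul_distrib, Fintype.piFinset_univ]

variable [∀ i, DecidableEq (X i)]

theorem tensorMatrix_mem_rowStochastic {M : ∀ i, Matrix (X i) (X i) ℝ}
    (h : ∀ i, M i ∈ Matrix.rowStochastic ℝ (X i)) :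
    tensorMatrix M ∈ Matrix.rowStochastic ℝ (∀ i, X i) :=
  Matrix.mem_rowStochastic_iff_sum.2
    ⟨fun _ _ => Finset.prod_nonneg fun i _ => Matrix.nonneg_of_mem_rowStochastic (h i),
      fun x => sum_prod_apply_eq_one fun i => Matrix.sum_row_of_mem_rowStochastic (h i) (x i)⟩

/-- The matrix `I ⊗ ⋯ ⊗ I ⊗ A ⊗ I ⊗ ⋯ ⊗ I` with the factor `A` at the place `i`, as an algebra
homomorphism in `A`. -/
noncomputable def coordinateMatrix (i : ι) :
    Matrix (X i) (X i) ℝ →ₐ[ℝ] Matrix (∀ i, X i) (∀ i, X i) ℝ :=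
  AlgHom.ofLinearMap
    { toFun := fun A => tensorMatrix (Function.update 1 i A)
      map_add' := fun A B => by
        ext x y
        simp only [tensorMatrix_update, Matrix.add_apply, add_mul]
      map_smul' := fun r A => by
        ext x y
        simp only [tensorMatrix_update, Matrix.smul_apply, smul_eq_mul, mul_assoc,
          RingHom.id_apply] }
    (by rw [LinearMap.coe_mk, AddHom.coe_mk, Function.update_one, tensorMatrix_one])
    fun A B => by
      simp only [LinearMap.coe_mk, AddHom.coe_mk, tensorMatrix_mul, ← Function.update_mul, mul_one]

theorem coordinateMatrix_apply (i : ι) (A : Matrix (X i) (X i) ℝ) :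
    coordinateMatrix i A = tensorMatrix (Function.update 1 i A) := rfl

theorem coordinateMatrix_mul_tensorMatrix (i : ι) (A : Matrix (X i) (X i) ℝ)
    (M : ∀ i, Matrix (X i) (X i) ℝ) :
    coordinateMatrix i A * tensorMatrix M = tensorMatrix (Function.update M i (A * M i)) := by
  rw [coordinateMatrix_apply, tensorMatrix_mul]
  congr 1
  conv_lhs => rw [← Function.update_eq_self i M, ← Function.update_mul, one_mul]

theorem commute_coordinateMatrix {i j : ι} (hij : i ≠ j) (A : Matrix (X i) (X i) ℝ)
    (B : Matrix (X j) (X j) ℝ) : Commute (coordinateMatrix i A) (coordinateMatrix j B) := by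
  rw [Commute, SemiconjBy, coordinateMatrix_apply j, coordinateMatrix_mul_tensorMatrix,
    ← coordinateMatrix_apply j, coordinateMatrix_apply i, coordinateMatrix_mul_tensorMatrix,
    Function.update_of_ne hij, Function.update_of_ne hij.symm, Pi.one_apply, Pi.one_apply, mul_one,
    mul_one, Function.update_comm hij.symm]

theorem exp_coordinateMatrix (i : ι) (A : Matrix (X i) (X i) ℝ) :
    NormedSpace.exp (coordinateMatrix i A) = coordinateMatrix i (NormedSpace.exp A) := by
  have hcont : Continuous (coordinateMatrix i : Matrix (X i) (X i) ℝ →ₐ[ℝ] _) :=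
    (coordinateMatrix i).toLinearMap.continuous_of_finiteDimensional
  let _ : NormedRing (Matrix (X i) (X i) ℝ) := Matrix.linftyOpNormedRing
  let _ : NormedAlgebra ℝ (Matrix (X i) (X i) ℝ) := Matrix.linftyOpNormedAlgebra
  let _ : NormedRing (Matrix (∀ i, X i) (∀ i, X i) ℝ) := Matrix.linftyOpNormedRing
  let _ : NormedAlgebra ℝ (Matrix (∀ i, X i) (∀ i, X i) ℝ) := Matrix.linftyOpNormedAlgebra
  exact (NormedSpace.map_exp_of_mem_ball (𝕂 := ℝ) (coordinateMatrix i) hcont A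
    ((NormedSpace.expSeries_radius_eq_top ℝ (Matrix (X i) (X i) ℝ)).symm ▸ edist_lt_top _ _)).symm

theorem exp_sum_coordinateMatrix (A : ∀ i, Matrix (X i) (X i) ℝ) (s : Finset ι) :
    NormedSpace.exp (∑ i ∈ s, coordinateMatrix i (A i)) =
      tensorMatrix (s.piecewise (fun i => NormedSpace.exp (A i)) 1) := by
  induction s using Finset.induction_on with
  | empty => simp [tensorMatrix_one]
  | insert i s hi ih =>
    have hcomm : Commute (coordinateMatrix i (A i)) (∑ j ∈ s, coordinateMatrix j (A j)) :=
      Commute.sum_right _ _ _ fun j hj =>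
        commute_coordinateMatrix (ne_of_mem_of_not_mem hj hi).symm _ _
    rw [Finset.sum_insert hi, Matrix.exp_add_of_commute _ _ hcomm, ih, exp_coordinateMatrix,
      coordinateMatrix_mul_tensorMatrix, Finset.piecewise_insert,
      Finset.piecewise_eq_of_notMem _ _ _ hi, Pi.one_apply, mul_one]

theorem productKernel_eq_sum (w : ι → ℝ) (K : ∀ i, Matrix (X i) (X i) ℝ) :
    productKernel w K = ∑ i, w i • coordinateMatrix i (K i) := by
  ext x y
  simp only [productKernel, Matrix.sum_apply, Matrix.smul_apply, smul_eq_mul,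
    coordinateMatrix_apply, tensorMatrix_update, Pi.one_apply]

theorem continuousKernel_productKernel {w : ι → ℝ} (hw : ∑ i, w i = 1)
    (K : ∀ i, Matrix (X i) (X i) ℝ) (t : ℝ) :
    continuousKernel (productKernel w K) t =
      tensorMatrix fun i => continuousKernel (K i) (w i * t) := by
  have hgen : (-t) • (1 - productKernel w K) =
      ∑ i, coordinateMatrix i ((-(w i * t)) • (1 - K i)) := by
    have hone : (1 : Matrix (∀ i, X i) (∀ i, X i) ℝ) = ∑ i, w i • coordinateMatrix i 1 := by
      simp only [map_one, ← Finset.sum_smul, hw, one_smul]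
    rw [productKernel_eq_sum, hone, ← Finset.sum_sub_distrib, Finset.smul_sum]
    refine Finset.sum_congr rfl fun i _ => ?_
    rw [← smul_sub, ← map_sub, smul_smul, map_smul, mul_comm (w i) t, neg_mul]
  rw [continuousKernel, hgen, exp_sum_coordinateMatrix, Finset.piecewise_univ]
  rfl

theorem productKernel_mem_rowStochastic {w : ι → ℝ} {K : ∀ i, Matrix (X i) (X i) ℝ}
    (hw0 : ∀ i, 0 ≤ w i) (hw : ∑ i, w i = 1) (hK : ∀ i, K i ∈ Matrix.rowStochastic ℝ (X i)) :
    productKernel w K ∈ Matrix.rowStochastic ℝ (∀ i, X i) := by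
  rw [productKernel_eq_sum]
  refine Matrix.convex_rowStochastic.sum_mem (fun i _ => hw0 i) hw fun i _ =>
    tensorMatrix_mem_rowStochastic fun j => ?_
  rcases eq_or_ne j i with rfl | hj
  · rw [Function.update_self]
    exact hK j
  · rw [Function.update_of_ne hj]
    exact one_mem _

variable {w : ι → ℝ} {K : ∀ i, Matrix (X i) (X i) ℝ} {π : ∀ i, X i → ℝ}

theorem continuousTV_productKernel_le [∀ i, Nonempty (X i)] (hw0 : ∀ i, 0 ≤ w i)
    (hw : ∑ i, w i = 1) (hK : ∀ i, K i ∈ Matrix.rowStochastic ℝ (X i))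
    (hπ : ∀ i, IsStationaryDistribution (K i) (π i)) {t : ℝ} (ht : 0 ≤ t) {z : ∀ i, X i}
    {β : ι → ℝ} (hβ0 : ∀ i, 0 ≤ β i)
    (hβ : ∀ i x, β i ≤ continuousKernel (K i) (w i * t) x (z i)) :
    continuousTV (productKernel w K) (productDistribution π) t ≤ 1 - ∏ i, β i := by
  refine continuousTV_le_one_sub (productKernel_mem_rowStochastic hw0 hw hK)
    (productDistribution_nonneg fun i => (hπ i).1) ht (z := z) ?_ fun x => ?_
  · exact Finset.prod_le_prod (fun i _ => hβ0 i) fun i _ =>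
      (hπ i).le_apply_of_le_continuousKernel (hβ i)
  · rw [continuousKernel_productKernel hw]
    exact Finset.prod_le_prod (fun i _ => hβ0 i) fun i _ => hβ i (x i)

theorem prod_sub_prod_le_continuousTV_productKernel (hw0 : ∀ i, 0 ≤ w i) (hw : ∑ i, w i = 1)
    (hK : ∀ i, K i ∈ Matrix.rowStochastic ℝ (X i))
    (hπ : ∀ i, IsStationaryDistribution (K i) (π i)) {t : ℝ} (ht : 0 ≤ t) (x z : ∀ i, X i) :
    ∏ i, π i (z i) - ∏ i, continuousKernel (K i) (w i * t) (x i) (z i) ≤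
      continuousTV (productKernel w K) (productDistribution π) t := by
  have hle := sub_le_continuousTV (productKernel_mem_rowStochastic hw0 hw hK)
    (sum_prod_apply_eq_one fun i => (hπ i).2.1 : ∑ x, productDistribution π x = 1) ht x z
  rwa [continuousKernel_productKernel hw] at hle

end ProductChains

/-! ### The coordinate chains -/

section LacoinKernel

variable {n : ℕ} {a b c : ℝ}

theorem sum_lacoinKernel_mul (hn : 1 ≤ n) (j : Fin (2 * n + 1)) (f : ℕ → ℝ) :
    ∑ k, lacoinKernel n a b c j k * f k =
      a * f (j - 1) + if (j : ℕ) = n then b * f (n + 1) + (1 - a - b) * f (2 * n)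
        else if (j : ℕ) = 2 * n then c * f n + (1 - a - c) * f (2 * n)
        else (1 - a) * f (j + 1) := by
  have hsum : ∀ (P : ℕ → Prop) [DecidablePred P] (r : ℝ) (v : ℕ), (∀ w, P w → w = v) →
      ∑ k : Fin (2 * n + 1), (if P k then r else 0) * f k =
        if P v ∧ v < 2 * n + 1 then r * f v else 0 := by
    intro P _ r v hP
    split_ifs with hv
    · rw [Finset.sum_eq_single (⟨v, hv.2⟩ : Fin (2 * n + 1)), if_pos hv.1]
      · intro k _ hk
        rw [if_neg fun hPk => hk (Fin.ext (hP k hPk)), zero_mul]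
      · exact fun h => absurd (Finset.mem_univ _) h
    · refine Finset.sum_eq_zero fun k _ => ?_
      rw [if_neg fun hPk => hv (hP k hPk ▸ ⟨hPk, k.isLt⟩), zero_mul]
  obtain ⟨j, hj⟩ := j
  simp only [lacoinKernel, add_mul, Finset.sum_add_distrib]
  rw [hsum (fun k => k = j + 1 ∧ j ≠ n) (1 - a) (j + 1) (by omega),
    hsum (fun k => j = 0 ∧ k = 0) a 0 (by omega),
    hsum (fun k => j = k + 1) a (j - 1) (by omega),
    hsum (fun k => j = n ∧ k = n + 1) b (n + 1) (by omega),
    hsum (fun k => j = n ∧ k = 2 * n) (1 - a - b) (2 * n) (by omega),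
    hsum (fun k => j = 2 * n ∧ k = n) c n (by omega),
    hsum (fun k => j = 2 * n ∧ k = 2 * n) (1 - a - c) (2 * n) (by omega)]
  grind

theorem lacoinKernel_mem_rowStochastic (hn : 1 ≤ n) (ha : 0 ≤ a) (hb : 0 ≤ b) (hab : a + b ≤ 1)
    (hc : 0 ≤ c) (hac : a + c ≤ 1) : lacoinKernel n a b c ∈ Matrix.rowStochastic ℝ _ := by
  refine Matrix.mem_rowStochastic_iff_sum.2 ⟨fun j k => ?_, fun j => ?_⟩
  · have h1 : 0 ≤ 1 - a := by linarith
    have h2 : 0 ≤ 1 - a - b := by linarith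
    have h3 : 0 ≤ 1 - a - c := by linarith
    unfold lacoinKernel
    positivity
  · have hrow := sum_lacoinKernel_mul (a := a) (b := b) (c := c) hn j fun _ => 1
    simp only [mul_one] at hrow
    rw [hrow]
    split_ifs <;> ring

theorem lacoinKernel_succ_self (hn : 2 ≤ n) {j : ℕ} (hj : j < 2 * n) :
    lacoinKernel n a b c ⟨j + 1, by omega⟩ ⟨j, by omega⟩ = a := by
  grind [lacoinKernel]

theorem lacoinKernel_last_mid (hn : 2 ≤ n) :
    lacoinKernel n a b c (Fin.last (2 * n)) ⟨n, by omega⟩ = c := by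
  grind [lacoinKernel]

theorem lacoinKernel_self_succ (hn : 2 ≤ n) {j : ℕ} (hj : j < 2 * n) :
    lacoinKernel n a b c ⟨j, by omega⟩ ⟨j + 1, by omega⟩ = if j = n then b else 1 - a := by
  grind [lacoinKernel]

/-- The probability that the chain started at `j` (read modulo `2 * n + 1`) is at the state `2n`
after `m` steps. The starting point is a natural number so that the truncated predecessor `0 - 1`
accounts for the loop at `0`. -/
noncomputable def arrivalProb (n : ℕ) (a b c : ℝ) (m j : ℕ) : ℝ :=
  (lacoinKernel n a b c ^ m) (Fin.ofNat _ j) (Fin.last (2 * n))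

theorem lacoinKernel_pow_apply_last (m : ℕ) (j : Fin (2 * n + 1)) :
    (lacoinKernel n a b c ^ m) j (Fin.last (2 * n)) = arrivalProb n a b c m j := by
  rw [arrivalProb, Fin.ofNat_val_eq_self]

theorem arrivalProb_zero {j : ℕ} (hj : j ≤ 2 * n) :
    arrivalProb n a b c 0 j = if j = 2 * n then 1 else 0 := by
  rw [arrivalProb, pow_zero, Matrix.one_apply]
  simp [Fin.ext_iff, Nat.mod_eq_of_lt (Nat.lt_succ_of_le hj)]

theorem arrivalProb_succ (hn : 1 ≤ n) (m : ℕ) {j : ℕ} (hj : j ≤ 2 * n) :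
    arrivalProb n a b c (m + 1) j =
      a * arrivalProb n a b c m (j - 1) +
        if j = n then b * arrivalProb n a b c m (n + 1) +
          (1 - a - b) * arrivalProb n a b c m (2 * n)
        else if j = 2 * n then c * arrivalProb n a b c m n +
          (1 - a - c) * arrivalProb n a b c m (2 * n)
        else (1 - a) * arrivalProb n a b c m (j + 1) := by
  have hstep := sum_lacoinKernel_mul (a := a) (b := b) (c := c) hn ⟨j, Nat.lt_succ_of_le hj⟩
    (arrivalProb n a b c m)
  simp_rw [← lacoinKernel_pow_apply_last, ← Matrix.mul_apply, ← pow_succ',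
    lacoinKernel_pow_apply_last] at hstep
  exact hstep

theorem arrivalProb_eq_zero (hn : 1 ≤ n) {m j : ℕ} (hm : j + m ≤ n) :
    arrivalProb n a b c m j = 0 := by
  induction m generalizing j with
  | zero => rw [arrivalProb_zero (by omega), if_neg (by omega)]
  | succ m ih =>
    rw [arrivalProb_succ hn m (by omega), if_neg (by omega), if_neg (by omega), ih (by omega),
      ih (by omega), mul_zero, mul_zero, add_zero]

end LacoinKernel

/-- The standing assumptions on a coordinate chain and its distribution. -/
structure IsLacoinChain (n : ℕ) (a b c : ℝ) (π : Fin (2 * n + 1) → ℝ) : Prop where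
  a_pos : 0 < a
  a_lt_b : a < b
  a_add_b_lt : a + b < 1 / 2
  c_nonneg : 0 ≤ c
  a_add_c_le : a + c ≤ 1
  stationary : IsStationaryDistribution (lacoinKernel n a b c) π
  reversible : IsReversibleChain (lacoinKernel n a b c) π

namespace IsLacoinChain

variable {n : ℕ} {a b c : ℝ} {π : Fin (2 * n + 1) → ℝ}

theorem b_pos (h : IsLacoinChain n a b c π) : 0 < b := h.a_pos.trans h.a_lt_b

theorem a_lt_half (h : IsLacoinChain n a b c π) : a < 1 / 2 := by linarith [h.a_add_b_lt, h.b_pos]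

theorem b_lt_half (h : IsLacoinChain n a b c π) : b < 1 / 2 := by linarith [h.a_add_b_lt, h.a_pos]

theorem mem_rowStochastic (h : IsLacoinChain n a b c π) (hn : 1 ≤ n) :
    lacoinKernel n a b c ∈ Matrix.rowStochastic ℝ _ :=
  lacoinKernel_mem_rowStochastic hn h.a_pos.le h.b_pos.le (by linarith [h.a_add_b_lt])
    h.c_nonneg h.a_add_c_le

theorem arrivalProb_nonneg (h : IsLacoinChain n a b c π) (hn : 1 ≤ n) (m j : ℕ) :
    0 ≤ arrivalProb n a b c m j :=
  Matrix.nonneg_of_mem_rowStochastic (pow_mem (h.mem_rowStochastic hn) m)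

theorem arrivalProb_le_one (h : IsLacoinChain n a b c π) (hn : 1 ≤ n) (m j : ℕ) :
    arrivalProb n a b c m j ≤ 1 :=
  Matrix.le_one_of_mem_rowStochastic (pow_mem (h.mem_rowStochastic hn) m)

theorem apply_le_succ (h : IsLacoinChain n a b c π) (hn : 2 ≤ n) {j : ℕ} (hj : j < 2 * n) :
    π ⟨j, by omega⟩ ≤ π ⟨j + 1, by omega⟩ := by
  have hbalance := h.reversible ⟨j, by omega⟩ ⟨j + 1, by omega⟩
  rw [lacoinKernel_succ_self hn hj, lacoinKernel_self_succ hn hj] at hbalance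
  have hright : a ≤ if j = n then b else 1 - a := by
    split_ifs
    exacts [h.a_lt_b.le, by linarith [h.a_lt_half]]
  refine le_of_mul_le_mul_right ?_ h.a_pos
  exact hbalance ▸ mul_le_mul_of_nonneg_left hright (h.stationary.1 _)

theorem monotone_distribution (h : IsLacoinChain n a b c π) (hn : 2 ≤ n) : Monotone π :=
  Fin.monotone_iff_le_succ.2 fun j => h.apply_le_succ hn j.isLt

theorem last_pos (h : IsLacoinChain n a b c π) (hn : 2 ≤ n) : 0 < π (Fin.last (2 * n)) := by
  by_contra! hlast
  have hsum : ∑ x, π x ≤ 0 := Finset.sum_nonpos fun x _ =>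
    (h.monotone_distribution hn (Fin.le_last x)).trans hlast
  linarith [h.stationary.2.1]

-- Both `n` and `2n - 1` exchange mass with `2n` at equilibrium, and `π` is monotone.
theorem c_le (h : IsLacoinChain n a b c π) (hn : 2 ≤ n) : c ≤ 2 * a := by
  have hjump := h.reversible (Fin.last (2 * n)) ⟨n, by omega⟩
  have hstep := h.reversible ⟨2 * n - 1, by omega⟩ ⟨2 * n - 1 + 1, by omega⟩
  have hlast : (⟨2 * n - 1 + 1, by omega⟩ : Fin (2 * n + 1)) = Fin.last (2 * n) :=
    Fin.ext (Nat.sub_add_cancel (by omega))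
  rw [lacoinKernel_last_mid hn] at hjump
  rw [lacoinKernel_succ_self hn (by omega), lacoinKernel_self_succ hn (by omega),
    if_neg (by omega), hlast] at hstep
  have hmono : π ⟨n, by omega⟩ ≤ π ⟨2 * n - 1, by omega⟩ :=
    h.monotone_distribution hn (by rw [Fin.mk_le_mk]; omega)
  refine le_of_mul_le_mul_left ?_ (h.last_pos hn)
  calc π (Fin.last (2 * n)) * c ≤ π ⟨n, by omega⟩ := hjump.trans_le <|
        mul_le_of_le_one_right (h.stationary.1 _)
          (Matrix.le_one_of_mem_rowStochastic (h.mem_rowStochastic (by omega)))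
    _ ≤ π ⟨2 * n - 1, by omega⟩ := hmono
    _ ≤ 2 * (π ⟨2 * n - 1, by omega⟩ * (1 - a)) := by
        nlinarith [h.stationary.1 ⟨2 * n - 1, by omega⟩, h.a_lt_half]
    _ = π (Fin.last (2 * n)) * (2 * a) := by rw [hstep]; ring

theorem pow_le_arrivalProb (h : IsLacoinChain n a b c π) (hn : 1 ≤ n) {m j : ℕ} (hj : j ≤ 2 * n)
    (hm : 2 * n ≤ m + j) : (1 - a - c) ^ m ≤ arrivalProb n a b c m j := by
  have hρ : 0 ≤ 1 - a - c := by linarith [h.a_add_c_le]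
  induction m generalizing j with
  | zero => rw [arrivalProb_zero hj, if_pos (by omega), pow_zero]
  | succ m ih =>
    have hpow : 0 ≤ (1 - a - c) ^ m := pow_nonneg hρ m
    have hleft := mul_nonneg h.a_pos.le (h.arrivalProb_nonneg hn m (j - 1))
    have hlast := ih le_rfl (by omega)
    rw [arrivalProb_succ hn m hj, pow_succ']
    split_ifs with hjn hjl
    · have hright := ih (j := n + 1) (by omega) (by omega)
      nlinarith [h.b_pos, h.a_add_b_lt, h.c_nonneg]
    · nlinarith [h.c_nonneg, h.arrivalProb_nonneg hn m n]
    · have hright := ih (j := j + 1) (by omega) (by omega)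
      nlinarith [h.a_lt_half, h.c_nonneg]

theorem mul_pow_le_arrivalProb_of_le (h : IsLacoinChain n a b c π) (hn : 1 ≤ n) {m j : ℕ}
    (hj : j ≤ n) (hm : n + 1 ≤ m + j) :
    (1 - a - b) * (1 - a - c) ^ m ≤ arrivalProb n a b c m j := by
  have hα : 0 ≤ 1 - a - b := by linarith [h.a_add_b_lt]
  have hρ : 0 ≤ 1 - a - c := by linarith [h.a_add_c_le]
  have hρ1 : 1 - a - c ≤ 1 - a := by linarith [h.c_nonneg]
  induction m generalizing j with
  | zero => omega
  | succ m ih =>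
    have hpow : 0 ≤ (1 - a - b) * (1 - a - c) ^ m := mul_nonneg hα (pow_nonneg hρ m)
    have hleft := mul_nonneg h.a_pos.le (h.arrivalProb_nonneg hn m (j - 1))
    rw [arrivalProb_succ hn m (by omega), if_neg (by omega : j ≠ 2 * n), pow_succ]
    split_ifs with hjn
    · have hslow := mul_nonneg h.b_pos.le (h.arrivalProb_nonneg hn m (n + 1))
      have hjump := mul_le_mul_of_nonneg_left
        (h.pow_le_arrivalProb hn (m := m) (le_refl (2 * n)) (by omega)) hα
      nlinarith [h.a_pos]
    · nlinarith [ih (j := j + 1) (by omega) (by omega), h.a_lt_half]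

theorem mul_pow_le_arrivalProb (h : IsLacoinChain n a b c π) (hn : 1 ≤ n) {m j : ℕ}
    (hj : j ≤ 2 * n) (hm : n + 1 ≤ m) :
    (1 - a - b) * (1 - a - c) ^ m ≤ arrivalProb n a b c m j := by
  rcases le_or_gt j n with hjn | hjn
  · exact h.mul_pow_le_arrivalProb_of_le hn hjn (by omega)
  · refine (mul_le_of_le_one_left ?_ ?_).trans (h.pow_le_arrivalProb hn hj (by omega))
    · exact pow_nonneg (by linarith [h.a_add_c_le]) m
    · linarith [h.a_pos, h.b_pos]

theorem mul_pow_le_one_sub_arrivalProb (h : IsLacoinChain n a b c π) (hn : 1 ≤ n) {m j : ℕ}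
    (hm : j + m < 2 * n) :
    (if j ≤ n then b else 1) * (1 - a) ^ m ≤ 1 - arrivalProb n a b c m j := by
  have hρ : 0 ≤ 1 - a := by linarith [h.a_lt_half]
  induction m generalizing j with
  | zero =>
    rw [arrivalProb_zero (by omega), if_neg (by omega : j ≠ 2 * n)]
    split_ifs <;> linarith [h.b_lt_half]
  | succ m ih =>
    have hpow : 0 ≤ (1 - a) ^ m := pow_nonneg hρ m
    have hright := ih (j := j + 1) (by omega)
    have hleft := mul_nonneg h.a_pos.le
      (sub_nonneg.2 (h.arrivalProb_le_one hn m (j - 1)))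
    rw [arrivalProb_succ hn m (by omega), if_neg (by omega : j ≠ 2 * n), pow_succ]
    rcases lt_trichotomy j n with hjn | rfl | hjn
    · rw [if_pos (by omega : j + 1 ≤ n)] at hright
      rw [if_pos hjn.le, if_neg hjn.ne]
      nlinarith
    · rw [if_neg (by omega : ¬j + 1 ≤ j)] at hright
      rw [if_pos le_rfl, if_pos rfl]
      have hjump := mul_nonneg (by linarith [h.a_add_b_lt] : 0 ≤ 1 - a - b)
        (sub_nonneg.2 (h.arrivalProb_le_one hn m (2 * j)))
      nlinarith [mul_nonneg h.b_pos.le hpow, h.a_pos, h.b_pos]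
    · rw [if_neg (by omega : ¬j + 1 ≤ n)] at hright
      rw [if_neg hjn.not_ge, if_neg hjn.ne']
      nlinarith

end IsLacoinChain

/-! ### Travel times of a coordinate -/

-- The exponent is a first order Taylor expansion away from `(u - r) * θ`; take
-- `θ = (u - r) / (u + r)`.
theorem exists_chernoff_tilt {r u : ℝ} (hr : 0 < r) (hu : 0 < u) (hru : r ≠ u) :
    ∃ θ κ, 0 < θ * (u - r) ∧ 0 < κ ∧ κ = u * (1 - Real.exp (-θ)) - r * θ := by
  have hsum : 0 < u + r := add_pos hu hr
  have hsq : 0 < (u - r) ^ 2 := sq_pos_of_ne_zero (sub_ne_zero.2 hru.symm)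
  obtain ⟨θ, hθ⟩ : ∃ θ, θ * (u + r) = u - r := ⟨(u - r) / (u + r), div_mul_cancel₀ _ hsum.ne'⟩
  have hsign : 0 < θ * (u - r) := by
    refine pos_of_mul_pos_left (b := u + r) ?_ hsum.le
    rwa [mul_right_comm, hθ, ← sq]
  have habs : |-θ| ≤ 1 := by
    rw [abs_neg, abs_le]
    constructor <;> nlinarith
  have htaylor := (abs_le.1 (Real.abs_exp_sub_one_sub_id_le habs)).2
  refine ⟨θ, _, hsign, ?_, rfl⟩
  have hdrift : u * θ ^ 2 < θ * (u - r) := by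
    have hθ0 : 0 < θ ^ 2 := sq_pos_of_ne_zero (left_ne_zero_of_mul hsign.ne')
    rw [← hθ]
    nlinarith
  nlinarith

/-- The probability that the continuous time coordinate chain started at `x` is at the state `2n`
at time `t`. -/
noncomputable abbrev continuousArrivalProb (n : ℕ) (a b c t : ℝ) (x : Fin (2 * n + 1)) : ℝ :=
  continuousKernel (lacoinKernel n a b c) t x (Fin.last (2 * n))

theorem hasSum_arrivalProb (n : ℕ) (a b c t : ℝ) (x : Fin (2 * n + 1)) :
    HasSum (fun m => poissonWeight t m * arrivalProb n a b c m x)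
      (continuousArrivalProb n a b c t x) := by
  simp_rw [← lacoinKernel_pow_apply_last]
  exact hasSum_continuousKernel _ t x _

theorem hasSum_one_sub_arrivalProb (n : ℕ) (a b c t : ℝ) (x : Fin (2 * n + 1)) :
    HasSum (fun m => poissonWeight t m * (1 - arrivalProb n a b c m x))
      (1 - continuousArrivalProb n a b c t x) := by
  simp_rw [← lacoinKernel_pow_apply_last]
  exact hasSum_one_sub_continuousKernel _ t x _

/-- The form of the error terms for a coordinate chain observed for a time of order `n`: `n * a`
accounts for the steps to the left, and the exponential for the deviations of the number of jumps
from its mean. -/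
noncomputable def travelError (C κ : ℝ) (n : ℕ) (a : ℝ) : ℝ := C * (n * a + Real.exp (-(κ * n)))

theorem travelError_nonneg {C a : ℝ} (κ : ℝ) (n : ℕ) (hC : 0 ≤ C) (ha : 0 ≤ a) :
    0 ≤ travelError C κ n a := by
  unfold travelError
  positivity

namespace IsLacoinChain

variable {n : ℕ} {a b c : ℝ} {π : Fin (2 * n + 1) → ℝ}

theorem continuousArrivalProb_nonneg (h : IsLacoinChain n a b c π) (hn : 1 ≤ n) {t : ℝ}
    (ht : 0 ≤ t) (x : Fin (2 * n + 1)) : 0 ≤ continuousArrivalProb n a b c t x :=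
  Matrix.nonneg_of_mem_rowStochastic
    (continuousKernel_mem_rowStochastic (h.mem_rowStochastic hn) ht)

theorem continuousArrivalProb_le_one (h : IsLacoinChain n a b c π) (hn : 1 ≤ n) {t : ℝ}
    (ht : 0 ≤ t) (x : Fin (2 * n + 1)) : continuousArrivalProb n a b c t x ≤ 1 :=
  Matrix.le_one_of_mem_rowStochastic
    (continuousKernel_mem_rowStochastic (h.mem_rowStochastic hn) ht)

theorem le_continuousArrivalProb_of_pow_le (h : IsLacoinChain n a b c π) (hn : 2 ≤ n)
    {N : ℕ} {α θ t : ℝ} (ht : 0 ≤ t) (hα : 0 ≤ α) (hθ : 0 < θ)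
    (hpow : ∀ m j, j ≤ 2 * n → N ≤ m → α * (1 - a - c) ^ m ≤ arrivalProb n a b c m j)
    (x : Fin (2 * n + 1)) :
    α * (1 - 3 * (t * a) - Real.exp (N * θ - t * (1 - Real.exp (-θ)))) ≤
      continuousArrivalProb n a b c t x := by
  refine le_trans (mul_le_mul_of_nonneg_left ?_ hα) (le_of_hasSum_poissonWeight_mul
    (hasSum_arrivalProb n a b c t x) (N := N) (θ := θ) (ρ := 1 - a - c) ht hα
    (by linarith [h.a_add_c_le]) (by linarith [h.a_pos, h.c_nonneg])
    (fun m => h.arrivalProb_nonneg (by omega) m x) fun m hm => ?_)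
  · have hexp := Real.one_sub_le_exp_neg (t * (1 - (1 - a - c)))
    nlinarith [mul_le_mul_of_nonneg_left (h.c_le hn) ht]
  · rw [mul_nonneg_iff_of_pos_left hθ, sub_nonneg, Nat.cast_le] at hm
    exact hpow m x (Nat.lt_succ_iff.1 x.isLt) hm

end IsLacoinChain

theorem exists_slow_arrival_error {u : ℝ} (hu : 2 < u) : ∃ C ≥ 0, ∃ κ > 0,
    ∀ {n : ℕ} {a b c : ℝ} {π : Fin (2 * n + 1) → ℝ}, 2 ≤ n → IsLacoinChain n a b c π →
    ∀ {t}, u * n ≤ t → ∀ x, 1 - travelError C κ n a ≤ continuousArrivalProb n a b c t x := by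
  obtain ⟨θ, κ, hθ, hκ0, hκ⟩ := exists_chernoff_tilt two_pos (by linarith : 0 < u) hu.ne
  refine ⟨3 * u + 1, by linarith, κ, hκ0, fun {n a b c π} hn h t ht x => ?_⟩
  refine le_continuousKernel_of_le (h.mem_rowStochastic (by omega)) ht (fun x => ?_) x
  have hbound := h.le_continuousArrivalProb_of_pow_le hn (N := 2 * n) (t := u * n) (by positivity)
    zero_le_one (pos_of_mul_pos_left hθ (by linarith))
    (fun m j hj hm => by simpa only [one_mul] using h.pow_le_arrivalProb (by omega) hj (by omega)) x
  have hexponent : ((2 * n : ℕ) : ℝ) * θ - u * n * (1 - Real.exp (-θ)) = -(κ * n) := by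
    rw [hκ]
    push_cast
    ring
  rw [one_mul, hexponent] at hbound
  refine le_trans ?_ hbound
  have hna : 0 ≤ n * a := mul_nonneg n.cast_nonneg h.a_pos.le
  unfold travelError
  nlinarith [Real.exp_pos (-(κ * n))]

theorem exists_distribution_last_error : ∃ C ≥ 0, ∃ κ > 0,
    ∀ {n : ℕ} {a b c : ℝ} {π : Fin (2 * n + 1) → ℝ}, 2 ≤ n → IsLacoinChain n a b c π →
    1 - travelError C κ n a ≤ π (Fin.last (2 * n)) := by
  obtain ⟨C, hC, κ, hκ, harrival⟩ := exists_slow_arrival_error (u := 3) (by norm_num)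
  exact ⟨C, hC, κ, hκ, fun hn h =>
    h.stationary.le_apply_of_le_continuousKernel (harrival hn h le_rfl)⟩

theorem exists_fast_arrival_error {u : ℝ} (hu : 1 < u) : ∃ C ≥ 0, ∃ κ > 0,
    ∀ {n : ℕ} {a b c : ℝ} {π : Fin (2 * n + 1) → ℝ}, 2 ≤ n → IsLacoinChain n a b c π →
    ∀ {t}, u * n ≤ t → ∀ x,
    (1 - b) * (1 - travelError C κ n a) ≤ continuousArrivalProb n a b c t x := by
  obtain ⟨θ, κ, hθ, hκ0, hκ⟩ := exists_chernoff_tilt one_pos (by linarith : 0 < u) hu.ne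
  refine ⟨3 * u + 2 + Real.exp θ, by positivity, κ, hκ0, fun {n a b c π} hn h t ht x => ?_⟩
  have hα : 0 ≤ 1 - a - b := by linarith [h.a_add_b_lt]
  refine le_continuousKernel_of_le (h.mem_rowStochastic (by omega)) ht (fun x => ?_) x
  have hbound := h.le_continuousArrivalProb_of_pow_le hn (N := n + 1) (t := u * n) (by positivity)
    hα (pos_of_mul_pos_left hθ (by linarith))
    (fun m j hj hm => h.mul_pow_le_arrivalProb (by omega) hj hm) x
  have hexponent : ((n + 1 : ℕ) : ℝ) * θ - u * n * (1 - Real.exp (-θ)) = θ + -(κ * n) := by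
    rw [hκ]
    push_cast
    ring
  rw [hexponent, Real.exp_add] at hbound
  have hna : a ≤ n * a := le_mul_of_one_le_left h.a_pos.le (by exact_mod_cast (by omega : 1 ≤ n))
  have hexp := Real.exp_pos (-(κ * n))
  set ε := 3 * (u * n * a) + Real.exp θ * Real.exp (-(κ * n)) with hε
  have hε0 : 0 ≤ ε := by have := h.a_pos; positivity
  have herror : 2 * a + ε ≤ travelError (3 * u + 2 + Real.exp θ) κ n a := by
    have hθna : 0 ≤ Real.exp θ * (n * a) := mul_nonneg (Real.exp_pos θ).le (h.a_pos.le.trans hna)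
    rw [hε, travelError]
    nlinarith
  calc (1 - b) * (1 - travelError (3 * u + 2 + Real.exp θ) κ n a)
      ≤ (1 - b) * (1 - (2 * a + ε)) :=
        mul_le_mul_of_nonneg_left (by linarith) (by linarith [h.b_lt_half])
    _ ≤ (1 - a - b) * (1 - ε) := by nlinarith [mul_nonneg h.a_pos.le hε0, h.a_pos, h.b_lt_half]
    _ ≤ continuousArrivalProb n a b c (u * n) x := by rwa [hε, ← sub_sub]

theorem exists_slow_travel_error {u : ℝ} (hu0 : 0 < u) (hu : u < 2) : ∃ C ≥ 0, ∃ κ > 0,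
    ∀ {n : ℕ} {a b c : ℝ} {π : Fin (2 * n + 1) → ℝ}, 1 ≤ n → IsLacoinChain n a b c π →
    ∀ {t}, 0 ≤ t → t ≤ u * n →
    b * (1 - travelError C κ n a) ≤ 1 - continuousArrivalProb n a b c t 0 := by
  obtain ⟨θ, κ, hθ, hκ0, hκ⟩ := exists_chernoff_tilt two_pos hu0 hu.ne'
  have hθ0 : θ < 0 := neg_of_mul_pos_left hθ (by linarith)
  refine ⟨2 + Real.exp (-θ), by positivity, κ, hκ0, fun {n a b c π} hn h t ht0 ht => ?_⟩
  refine le_trans (mul_le_mul_of_nonneg_left ?_ h.b_pos.le) (le_of_hasSum_poissonWeight_mul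
    (hasSum_one_sub_arrivalProb n a b c t 0) (N := 2 * n - 1) (θ := θ) (ρ := 1 - a) ht0 h.b_pos.le
    (by linarith [h.a_lt_half]) (by linarith [h.a_pos])
    (fun m => sub_nonneg.2 (h.arrivalProb_le_one hn m _)) fun m hm => ?_)
  · have hstay := Real.one_sub_le_exp_neg (t * (1 - (1 - a)))
    have hleft : t * a ≤ 2 * (n * a) := by
      rw [← mul_assoc]
      exact mul_le_mul_of_nonneg_right (ht.trans (by gcongr)) h.a_pos.le
    have hjumps : Real.exp ((2 * n - 1) * θ - t * (1 - Real.exp (-θ))) ≤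
        Real.exp (-θ) * Real.exp (-(κ * n)) := by
      rw [← Real.exp_add, Real.exp_le_exp, hκ]
      nlinarith [Real.one_lt_exp_iff.2 (neg_pos.2 hθ0)]
    have hna : 0 ≤ n * a := mul_nonneg n.cast_nonneg h.a_pos.le
    unfold travelError
    nlinarith [Real.exp_pos (-(κ * n)), Real.exp_pos (-θ)]
  · have hm' : (m : ℝ) < 2 * n := by nlinarith
    have hbound := h.mul_pow_le_one_sub_arrivalProb hn (m := m) (j := 0)
      (by rw [zero_add]; exact_mod_cast hm')
    rwa [if_pos n.zero_le] at hbound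

theorem exists_fast_travel_error {u : ℝ} (hu0 : 0 < u) (hu : u < 1) : ∃ κ > 0,
    ∀ {n : ℕ} {a b c : ℝ} {π : Fin (2 * n + 1) → ℝ}, 1 ≤ n → IsLacoinChain n a b c π →
    continuousArrivalProb n a b c (u * n) 0 ≤ Real.exp (-(κ * n)) := by
  obtain ⟨θ, κ, hθ, hκ0, hκ⟩ := exists_chernoff_tilt one_pos hu0 hu.ne'
  have hθ0 : θ < 0 := neg_of_mul_pos_left hθ (by linarith)
  refine ⟨κ, hκ0, fun {n a b c π} hn h => ?_⟩
  have hbound := le_of_hasSum_poissonWeight_mul (hasSum_one_sub_arrivalProb n a b c (u * n) 0)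
    (N := n) (θ := θ) (α := 1) (ρ := 1) (by positivity) zero_le_one zero_le_one le_rfl
    (fun m => sub_nonneg.2 (h.arrivalProb_le_one hn m _)) fun m hm => ?_
  · have hexponent : n * θ - u * n * (1 - Real.exp (-θ)) = -(κ * n) := by
      rw [hκ]
      ring
    rw [one_mul, sub_self, mul_zero, neg_zero, Real.exp_zero, hexponent] at hbound
    linarith
  · have hmn : (m : ℝ) ≤ n := by nlinarith [hθ0]
    rw [Fin.val_zero, arrivalProb_eq_zero hn (by rw [zero_add]; exact_mod_cast hmn), one_pow,
      one_mul, sub_zero]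

/-- A family of errors attached to the coordinates, negligible even when added up over them. -/
structure IsNegligible (ε : ∀ n : ℕ, Fin n → ℝ) : Prop where
  nonneg : ∀ n i, 0 ≤ ε n i
  tendsto_sum : Tendsto (fun n => ∑ i, ε n i) atTop (𝓝 0)

theorem IsNegligible.add {ε₁ ε₂ : ∀ n : ℕ, Fin n → ℝ} (h₁ : IsNegligible ε₁)
    (h₂ : IsNegligible ε₂) : IsNegligible (ε₁ + ε₂) where
  nonneg n i := add_nonneg (h₁.nonneg n i) (h₂.nonneg n i)
  tendsto_sum := by
    simpa only [Pi.add_apply, Finset.sum_add_distrib, add_zero] using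
      h₁.tendsto_sum.add h₂.tendsto_sum

theorem IsNegligible.eventually_sum_le {ε : ∀ n : ℕ, Fin n → ℝ} (h : IsNegligible ε) {η : ℝ}
    (hη : 0 < η) : ∀ᶠ n in atTop, ∑ i, ε n i ≤ η :=
  (h.tendsto_sum.eventually_lt_const hη).mono fun _ => le_of_lt

theorem tendsto_exp_neg_mul_natCast {κ : ℝ} (hκ : 0 < κ) :
    Tendsto (fun n : ℕ => Real.exp (-(κ * n))) atTop (𝓝 0) :=
  Real.tendsto_exp_neg_atTop_nhds_zero.comp (tendsto_natCast_atTop_atTop.const_mul_atTop hκ)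

theorem tendsto_natCast_mul_exp_neg_mul {κ : ℝ} (hκ : 0 < κ) :
    Tendsto (fun n : ℕ => (n : ℝ) * Real.exp (-(κ * n))) atTop (𝓝 0) := by
  refine ((tendsto_rpow_mul_exp_neg_mul_atTop_nhds_zero 1 κ hκ).comp
    tendsto_natCast_atTop_atTop).congr fun n => ?_
  rw [Function.comp_apply, Real.rpow_one, neg_mul]

theorem tendsto_natCast_mul_of_isLittleO_one_div {f : ℕ → ℝ}
    (hf : f =o[atTop] fun n : ℕ => 1 / (n : ℝ)) :
    Tendsto (fun n : ℕ => (n : ℝ) * f n) atTop (𝓝 0) := by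
  rw [← isLittleO_one_iff ℝ]
  refine ((isBigO_refl (fun n : ℕ => (n : ℝ)) atTop).mul_isLittleO hf).congr' .rfl ?_
  filter_upwards [eventually_ne_atTop 0] with n hn
  exact mul_one_div_cancel (Nat.cast_ne_zero.2 hn)

theorem isNegligible_travelError {a : ∀ n : ℕ, Fin n → ℝ} (ha : ∀ n i, 0 ≤ a n i)
    (hsum : (fun n => ∑ i, a n i) =o[atTop] fun n : ℕ => 1 / (n : ℝ)) {C κ : ℝ} (hC : 0 ≤ C)
    (hκ : 0 < κ) : IsNegligible fun n i => travelError C κ n (a n i) where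
  nonneg n i := travelError_nonneg κ n hC (ha n i)
  tendsto_sum := by
    have hlim := ((tendsto_natCast_mul_of_isLittleO_one_div hsum).add
      (tendsto_natCast_mul_exp_neg_mul hκ)).const_mul C
    simp only [add_zero, mul_zero] at hlim
    refine hlim.congr fun n => ?_
    simp only [travelError]
    rw [← Finset.mul_sum, Finset.sum_add_distrib, ← Finset.mul_sum, Finset.sum_const,
      Finset.card_univ, Fintype.card_fin, nsmul_eq_mul]

/-! ### The product family -/

theorem exp_neg_two_mul_le_one_sub {x : ℝ} (hx0 : 0 ≤ x) (hx : x ≤ 1 / 2) :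
    Real.exp (-(2 * x)) ≤ 1 - x := by
  have hinv : Real.exp (-(2 * x)) ≤ (1 + 2 * x)⁻¹ := by
    rw [Real.exp_neg]
    exact inv_anti₀ (by linarith) (by linarith [Real.add_one_le_exp (2 * x)])
  refine hinv.trans ((inv_le_iff_one_le_mul₀ (by linarith)).2 ?_)
  nlinarith

section Products

variable {ι : Type*} {s : Finset ι} {β ε f : ι → ℝ}

theorem one_sub_sum_le_prod_one_sub (hε0 : ∀ i ∈ s, 0 ≤ ε i) (hε1 : ∀ i ∈ s, ε i ≤ 1) :
    1 - ∑ i ∈ s, ε i ≤ ∏ i ∈ s, (1 - ε i) := by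
  induction s using Finset.cons_induction with
  | empty => simp
  | cons i s hi ih =>
    rw [Finset.forall_mem_cons] at hε0 hε1
    rw [Finset.sum_cons, Finset.prod_cons]
    have hsum := Finset.sum_nonneg hε0.2
    nlinarith [mul_le_mul_of_nonneg_left (ih hε0.2 hε1.2) (sub_nonneg.2 hε1.1),
      mul_nonneg hε0.1 hsum]

theorem exp_mul_one_sub_sum_le_prod (hβ0 : ∀ i ∈ s, 0 ≤ β i) (hβ : ∀ i ∈ s, β i ≤ 1 / 2)
    (hε0 : ∀ i ∈ s, 0 ≤ ε i) (hε : ∑ i ∈ s, ε i ≤ 1) :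
    Real.exp (-(2 * ∑ i ∈ s, β i)) * (1 - ∑ i ∈ s, ε i) ≤ ∏ i ∈ s, (1 - β i) * (1 - ε i) := by
  have hexp : Real.exp (-(2 * ∑ i ∈ s, β i)) ≤ ∏ i ∈ s, (1 - β i) := by
    rw [Finset.mul_sum, ← Finset.sum_neg_distrib, Real.exp_sum]
    exact Finset.prod_le_prod (fun i _ => (Real.exp_pos _).le) fun i hi =>
      exp_neg_two_mul_le_one_sub (hβ0 i hi) (hβ i hi)
  rw [Finset.prod_mul_distrib]
  exact mul_le_mul hexp
    (one_sub_sum_le_prod_one_sub hε0 fun i hi => (Finset.single_le_sum hε0 hi).trans hε)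
    (sub_nonneg.2 hε) ((Real.exp_pos _).le.trans hexp)

theorem prod_le_exp_neg_half_sum (hβ0 : ∀ i ∈ s, 0 ≤ β i) (hε : ∀ i ∈ s, ε i ≤ 1 / 2)
    (hf0 : ∀ i ∈ s, 0 ≤ f i) (hf : ∀ i ∈ s, β i * (1 - ε i) ≤ 1 - f i) :
    ∏ i ∈ s, f i ≤ Real.exp (-((∑ i ∈ s, β i) / 2)) := by
  rw [Finset.sum_div, ← Finset.sum_neg_distrib, Real.exp_sum]
  refine Finset.prod_le_prod hf0 fun i hi => ?_
  nlinarith [Real.one_sub_le_exp_neg (β i / 2), hβ0 i hi, hε i hi, hf i hi]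

end Products

/-- The time scale `q_n n / p̂_n`: in `s` units of it, the coordinate `i` runs for the time
`s n p_{n,i} / p̂_n`. -/
noncomputable def lacoinScale (p : ∀ n : ℕ, Fin n → ℝ) (n : ℕ) : ℝ :=
  lacoinQ p n * n / lacoinPhat p n

section Weights

variable {p b : ∀ n : ℕ, Fin n → ℝ} {n : ℕ}

theorem lacoinQ_pos (hp : ∀ n i, 0 < p n i) (hn : 1 ≤ n) : 0 < lacoinQ p n :=
  have : Nonempty (Fin n) := ⟨⟨0, hn⟩⟩
  Finset.sum_pos (fun i _ => hp n i) Finset.univ_nonempty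

theorem sum_div_lacoinQ (hp : ∀ n i, 0 < p n i) (hn : 1 ≤ n) : ∑ i, p n i / lacoinQ p n = 1 := by
  rw [← Finset.sum_div]
  exact div_self (lacoinQ_pos hp hn).ne'

theorem lacoinPhat_le (p : ∀ n : ℕ, Fin n → ℝ) (n : ℕ) (i : Fin n) : lacoinPhat p n ≤ p n i :=
  ciInf_le (Set.finite_range _).bddBelow i

theorem exists_eq_lacoinPhat (p : ∀ n : ℕ, Fin n → ℝ) (hn : 1 ≤ n) :
    ∃ i, p n i = lacoinPhat p n :=
  have : Nonempty (Fin n) := ⟨⟨0, hn⟩⟩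
  exists_eq_ciInf_of_finite

theorem lacoinPhat_nonneg (hp : ∀ n i, 0 < p n i) (n : ℕ) : 0 ≤ lacoinPhat p n :=
  Real.iInf_nonneg fun i => (hp n i).le

theorem lacoinPhat_pos (hp : ∀ n i, 0 < p n i) (hn : 1 ≤ n) : 0 < lacoinPhat p n := by
  obtain ⟨i, hi⟩ := exists_eq_lacoinPhat p hn
  exact hi ▸ hp n i

theorem lacoinScale_pos (hp : ∀ n i, 0 < p n i) (hn : 1 ≤ n) : 0 < lacoinScale p n :=
  div_pos (mul_pos (lacoinQ_pos hp hn) (Nat.cast_pos.2 hn)) (lacoinPhat_pos hp hn)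

theorem div_lacoinQ_mul_lacoinScale (hp : ∀ n i, 0 < p n i) (hn : 1 ≤ n) (i : Fin n) (s : ℝ) :
    p n i / lacoinQ p n * (s * lacoinScale p n) = s * (p n i / lacoinPhat p n) * n := by
  have hQ := (lacoinQ_pos hp hn).ne'
  unfold lacoinScale
  field_simp

theorem mul_le_div_lacoinQ_mul_lacoinScale (hp : ∀ n i, 0 < p n i) (hn : 1 ≤ n) {i : Fin n}
    {s δ : ℝ} (hs : 0 ≤ s) (hi : (1 + δ) * lacoinPhat p n ≤ p n i) :
    s * (1 + δ) * n ≤ p n i / lacoinQ p n * (s * lacoinScale p n) := by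
  rw [div_lacoinQ_mul_lacoinScale hp hn]
  gcongr
  exact (le_div_iff₀ (lacoinPhat_pos hp hn)).2 hi

theorem div_lacoinQ_mul_lacoinScale_le (hp : ∀ n i, 0 < p n i) (hn : 1 ≤ n) {i : Fin n}
    {s δ : ℝ} (hs : 0 ≤ s) (hi : p n i ≤ (1 + δ) * lacoinPhat p n) :
    p n i / lacoinQ p n * (s * lacoinScale p n) ≤ s * (1 + δ) * n := by
  rw [div_lacoinQ_mul_lacoinScale hp hn]
  gcongr
  exact (div_le_iff₀ (lacoinPhat_pos hp hn)).2 hi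

/-- The contribution of the coordinate `i` to `B_n(δ)`. -/
noncomputable def slowMass (p b : ∀ n : ℕ, Fin n → ℝ) (n : ℕ) (δ : ℝ) (i : Fin n) : ℝ :=
  if p n i < (1 + δ) * lacoinPhat p n then b n i else 0

theorem sum_slowMass (p b : ∀ n : ℕ, Fin n → ℝ) (n : ℕ) (δ : ℝ) :
    ∑ i, slowMass p b n δ i = lacoinB p b n δ :=
  (Finset.sum_filter _ _).symm

theorem slowMass_nonneg (hb : ∀ n i, 0 ≤ b n i) (n : ℕ) (δ : ℝ) (i : Fin n) :
    0 ≤ slowMass p b n δ i := by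
  unfold slowMass
  split_ifs
  exacts [hb n i, le_rfl]

theorem lacoinB_nonneg (hb : ∀ n i, 0 ≤ b n i) (n : ℕ) (δ : ℝ) : 0 ≤ lacoinB p b n δ :=
  Finset.sum_nonneg fun i _ => hb n i

theorem lacoinB_mono (hp : ∀ n i, 0 < p n i) (hb : ∀ n i, 0 ≤ b n i) (n : ℕ) :
    Monotone (lacoinB p b n) := fun δ δ' h =>
  Finset.sum_le_sum_of_subset_of_nonneg (Finset.monotone_filter_right _ fun i _ hi =>
    hi.trans_le (mul_le_mul_of_nonneg_right (by linarith) (lacoinPhat_nonneg hp n)))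
    fun i _ _ => hb n i

theorem lacoinB_zero (p b : ∀ n : ℕ, Fin n → ℝ) (n : ℕ) : lacoinB p b n 0 = 0 := by
  rw [lacoinB, add_zero, one_mul, Finset.filter_false_of_mem, Finset.sum_empty]
  exact fun i _ => (lacoinPhat_le p n i).not_gt

end Weights

section Family

variable {p a b c : ∀ n : ℕ, Fin n → ℝ} {π : ∀ n : ℕ, Fin n → Fin (2 * n + 1) → ℝ}

section FixedSize

variable {n : ℕ} {t : ℝ}

theorem div_lacoinQ_mul_nonneg (hp : ∀ n i, 0 < p n i) (hn : 1 ≤ n) (ht : 0 ≤ t) (i : Fin n) :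
    0 ≤ p n i / lacoinQ p n * t :=
  mul_nonneg (div_nonneg (hp n i).le (lacoinQ_pos hp hn).le) ht

theorem lacoin_productKernel_mem_rowStochastic (hp : ∀ n i, 0 < p n i)
    (hL : ∀ n i, IsLacoinChain n (a n i) (b n i) (c n i) (π n i)) (hn : 1 ≤ n) :
    productKernel (fun i => p n i / lacoinQ p n)
      (fun i => lacoinKernel n (a n i) (b n i) (c n i)) ∈ Matrix.rowStochastic ℝ _ :=
  productKernel_mem_rowStochastic (fun i => div_nonneg (hp n i).le (lacoinQ_pos hp hn).le)
    (sum_div_lacoinQ hp hn) fun i => (hL n i).mem_rowStochastic hn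

theorem lacoinTV_antitone (hp : ∀ n i, 0 < p n i)
    (hL : ∀ n i, IsLacoinChain n (a n i) (b n i) (c n i) (π n i)) (hn : 1 ≤ n) :
    Antitone (lacoinTV p a b c π n) :=
  continuousTV_antitone (lacoin_productKernel_mem_rowStochastic hp hL hn)

theorem lacoinTV_nonneg (p a b c : ∀ n : ℕ, Fin n → ℝ)
    (π : ∀ n : ℕ, Fin n → Fin (2 * n + 1) → ℝ) (n : ℕ) (t : ℝ) : 0 ≤ lacoinTV p a b c π n t :=
  continuousTV_nonneg _ _ _

theorem lacoinTV_le_one (hp : ∀ n i, 0 < p n i)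
    (hL : ∀ n i, IsLacoinChain n (a n i) (b n i) (c n i) (π n i)) (hn : 1 ≤ n) (ht : 0 ≤ t) :
    lacoinTV p a b c π n t ≤ 1 :=
  continuousTV_le_one (lacoin_productKernel_mem_rowStochastic hp hL hn)
    (productDistribution_nonneg fun i => (hL n i).stationary.1) ht

theorem lacoinTV_le_one_sub_prod (hp : ∀ n i, 0 < p n i)
    (hL : ∀ n i, IsLacoinChain n (a n i) (b n i) (c n i) (π n i)) (hn : 1 ≤ n) (ht : 0 ≤ t)
    {β : Fin n → ℝ} (hβ0 : ∀ i, 0 ≤ β i)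
    (hβ : ∀ i x, β i ≤
      continuousArrivalProb n (a n i) (b n i) (c n i) (p n i / lacoinQ p n * t) x) :
    lacoinTV p a b c π n t ≤ 1 - ∏ i, β i :=
  continuousTV_productKernel_le (fun i => div_nonneg (hp n i).le (lacoinQ_pos hp hn).le)
    (sum_div_lacoinQ hp hn) (fun i => (hL n i).mem_rowStochastic hn)
    (fun i => (hL n i).stationary) ht (z := fun _ => Fin.last (2 * n)) hβ0 hβ

theorem prod_sub_prod_le_lacoinTV (hp : ∀ n i, 0 < p n i)
    (hL : ∀ n i, IsLacoinChain n (a n i) (b n i) (c n i) (π n i)) (hn : 1 ≤ n) (ht : 0 ≤ t) :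
    ∏ i, π n i (Fin.last (2 * n)) -
        ∏ i, continuousArrivalProb n (a n i) (b n i) (c n i) (p n i / lacoinQ p n * t) 0 ≤
      lacoinTV p a b c π n t :=
  prod_sub_prod_le_continuousTV_productKernel
    (fun i => div_nonneg (hp n i).le (lacoinQ_pos hp hn).le) (sum_div_lacoinQ hp hn)
    (fun i => (hL n i).mem_rowStochastic hn) (fun i => (hL n i).stationary) ht
    (fun _ => 0) fun _ => Fin.last (2 * n)

end FixedSize

theorem exists_arrival_error (hp : ∀ n i, 0 < p n i)
    (hL : ∀ n i, IsLacoinChain n (a n i) (b n i) (c n i) (π n i))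
    (hsum : (fun n => ∑ i, a n i) =o[atTop] fun n : ℕ => 1 / (n : ℝ))
    {s δ : ℝ} (hs : 1 < s) (hδ : 2 < s * (1 + δ)) :
    ∃ ε, IsNegligible ε ∧ ∀ n ≥ 2, ∀ i x, (1 - slowMass p b n δ i) * (1 - ε n i) ≤
      continuousArrivalProb n (a n i) (b n i) (c n i)
        (p n i / lacoinQ p n * (s * lacoinScale p n)) x := by
  obtain ⟨C₁, hC₁, κ₁, hκ₁, hfast⟩ := exists_fast_arrival_error hs
  obtain ⟨C₂, hC₂, κ₂, hκ₂, hslow⟩ := exists_slow_arrival_error hδ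
  have ha : ∀ n i, 0 ≤ a n i := fun n i => (hL n i).a_pos.le
  have hε₁ := isNegligible_travelError ha hsum hC₁ hκ₁
  have hε₂ := isNegligible_travelError ha hsum hC₂ hκ₂
  refine ⟨_, hε₁.add hε₂, fun n hn i x => ?_⟩
  have hs0 : 0 ≤ s := by linarith
  have hb := (hL n i).b_lt_half
  have hε₁0 := hε₁.nonneg n i
  have hε₂0 := hε₂.nonneg n i
  rw [Pi.add_apply, Pi.add_apply, slowMass]
  split_ifs with hi
  · have htime := mul_le_div_lacoinQ_mul_lacoinScale hp (by omega : 1 ≤ n) hs0 (δ := 0) (i := i)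
      (by rw [add_zero, one_mul]; exact lacoinPhat_le p n i)
    rw [add_zero, mul_one] at htime
    exact (mul_le_mul_of_nonneg_left (by linarith) (by linarith)).trans
      (hfast hn (hL n i) htime x)
  · have htime := mul_le_div_lacoinQ_mul_lacoinScale hp (by omega : 1 ≤ n) hs0 (not_lt.1 hi)
    exact le_trans (by linarith) (hslow hn (hL n i) htime x)

theorem exists_travel_error (hp : ∀ n i, 0 < p n i)
    (hL : ∀ n i, IsLacoinChain n (a n i) (b n i) (c n i) (π n i))
    (hsum : (fun n => ∑ i, a n i) =o[atTop] fun n : ℕ => 1 / (n : ℝ))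
    {s δ : ℝ} (hs : 0 < s) (hδ : s * (1 + δ) < 2) :
    ∃ ε, IsNegligible ε ∧ ∀ n ≥ 1, ∀ i, slowMass p b n δ i * (1 - ε n i) ≤
      1 - continuousArrivalProb n (a n i) (b n i) (c n i)
        (p n i / lacoinQ p n * (s * lacoinScale p n)) 0 := by
  obtain ⟨C, hC, κ, hκ, hslow⟩ := exists_slow_travel_error (u := max (s * (1 + δ)) 1)
    (lt_max_of_lt_right one_pos) (max_lt hδ one_lt_two)
  refine ⟨_, isNegligible_travelError (fun n i => (hL n i).a_pos.le) hsum hC hκ,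
    fun n hn i => ?_⟩
  have htime0 := div_lacoinQ_mul_nonneg hp hn (mul_nonneg hs.le (lacoinScale_pos hp hn).le) i
  rw [slowMass]
  split_ifs with hi
  · exact hslow hn (hL n i) htime0 <|
      (div_lacoinQ_mul_lacoinScale_le hp hn hs.le hi.le).trans (by gcongr; exact le_max_left _ _)
  · rw [zero_mul]
    exact sub_nonneg.2 ((hL n i).continuousArrivalProb_le_one hn htime0 0)

theorem eventually_one_sub_le_prod_distribution
    (hL : ∀ n i, IsLacoinChain n (a n i) (b n i) (c n i) (π n i))
    (hsum : (fun n => ∑ i, a n i) =o[atTop] fun n : ℕ => 1 / (n : ℝ)) {η : ℝ} (hη : 0 < η) :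
    ∀ᶠ n in atTop, 1 - η ≤ ∏ i, π n i (Fin.last (2 * n)) := by
  obtain ⟨C, hC, κ, hκ, hlast⟩ := exists_distribution_last_error
  have hε := isNegligible_travelError (fun n i => (hL n i).a_pos.le) hsum hC hκ
  filter_upwards [eventually_ge_atTop 2, hε.eventually_sum_le (lt_min hη one_pos)] with n hn hεn
  have hε1 : ∀ i, travelError C κ n (a n i) ≤ 1 := fun i =>
    (Finset.single_le_sum (fun j _ => hε.nonneg n j) (Finset.mem_univ i)).trans
      (hεn.trans (min_le_right _ _))
  calc 1 - η ≤ 1 - ∑ i, travelError C κ n (a n i) := by linarith [min_le_left η 1]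
    _ ≤ ∏ i, (1 - travelError C κ n (a n i)) :=
        one_sub_sum_le_prod_one_sub (fun i _ => hε.nonneg n i) fun i _ => hε1 i
    _ ≤ ∏ i, π n i (Fin.last (2 * n)) :=
        Finset.prod_le_prod (fun i _ => sub_nonneg.2 (hε1 i)) fun i _ => hlast hn (hL n i)

theorem eventually_lacoinTV_le (hp : ∀ n i, 0 < p n i)
    (hL : ∀ n i, IsLacoinChain n (a n i) (b n i) (c n i) (π n i))
    (hsum : (fun n => ∑ i, a n i) =o[atTop] fun n : ℕ => 1 / (n : ℝ))
    {s δ η : ℝ} (hs : 1 < s) (hδ : 2 < s * (1 + δ)) (hη : 0 < η) :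
    ∀ᶠ n in atTop, lacoinTV p a b c π n (s * lacoinScale p n) ≤
      1 - Real.exp (-(2 * lacoinB p b n δ)) + η := by
  obtain ⟨ε, hε, harrival⟩ := exists_arrival_error hp hL hsum hs hδ
  have hb : ∀ n i, 0 ≤ b n i := fun n i => (hL n i).b_pos.le
  filter_upwards [eventually_ge_atTop 2, hε.eventually_sum_le (lt_min hη one_pos)] with n hn hεn
  have hn1 : 1 ≤ n := by omega
  have hεsum : ∑ i, ε n i ≤ 1 := hεn.trans (min_le_right _ _)
  have hε1 : ∀ i, ε n i ≤ 1 := fun i =>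
    (Finset.single_le_sum (fun j _ => hε.nonneg n j) (Finset.mem_univ i)).trans hεsum
  have hmass : ∀ i, slowMass p b n δ i ≤ 1 / 2 := fun i => by
    unfold slowMass
    split_ifs
    exacts [(hL n i).b_lt_half.le, one_half_pos.le]
  have hTV := lacoinTV_le_one_sub_prod hp hL hn1
    (mul_nonneg (by linarith) (lacoinScale_pos hp hn1).le)
    (fun i => mul_nonneg (by linarith [hmass i]) (sub_nonneg.2 (hε1 i))) (harrival n hn)
  have hprod := exp_mul_one_sub_sum_le_prod (s := Finset.univ)
    (fun i _ => slowMass_nonneg (p := p) hb n δ i) (fun i _ => hmass i)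
    (fun i _ => hε.nonneg n i) hεsum
  rw [sum_slowMass] at hprod
  have hexp : Real.exp (-(2 * lacoinB p b n δ)) ≤ 1 :=
    Real.exp_le_one_iff.2 (by linarith [lacoinB_nonneg (p := p) hb n δ])
  have herror := mul_le_of_le_one_left
    (Finset.sum_nonneg fun i (_ : i ∈ Finset.univ) => hε.nonneg n i) hexp
  linarith [min_le_left η 1]

theorem eventually_le_lacoinTV (hp : ∀ n i, 0 < p n i)
    (hL : ∀ n i, IsLacoinChain n (a n i) (b n i) (c n i) (π n i))
    (hsum : (fun n => ∑ i, a n i) =o[atTop] fun n : ℕ => 1 / (n : ℝ))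
    {s δ η : ℝ} (hs : 0 < s) (hδ : s * (1 + δ) < 2) (hη : 0 < η) :
    ∀ᶠ n in atTop, 1 - Real.exp (-(lacoinB p b n δ / 2)) - η ≤
      lacoinTV p a b c π n (s * lacoinScale p n) := by
  obtain ⟨ε, hε, htravel⟩ := exists_travel_error hp hL hsum hs hδ
  filter_upwards [eventually_ge_atTop 1, hε.eventually_sum_le one_half_pos,
    eventually_one_sub_le_prod_distribution hL hsum hη] with n hn hεn hlast
  have ht := mul_nonneg hs.le (lacoinScale_pos hp hn).le
  have hprod := prod_le_exp_neg_half_sum (s := Finset.univ)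
    (fun i _ => slowMass_nonneg (fun n i => (hL n i).b_pos.le) n δ i)
    (fun i hi => (Finset.single_le_sum (fun j _ => hε.nonneg n j) hi).trans hεn)
    (fun i _ => (hL n i).continuousArrivalProb_nonneg hn (div_lacoinQ_mul_nonneg hp hn ht i) 0)
    fun i _ => htravel n hn i
  rw [sum_slowMass] at hprod
  linarith [prod_sub_prod_le_lacoinTV hp hL hn ht]

-- A coordinate with the least weight has most likely not arrived at time `s * lacoinScale p n`.
theorem tendsto_lacoinTV_one (hp : ∀ n i, 0 < p n i)
    (hL : ∀ n i, IsLacoinChain n (a n i) (b n i) (c n i) (π n i))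
    (hsum : (fun n => ∑ i, a n i) =o[atTop] fun n : ℕ => 1 / (n : ℝ))
    {s : ℝ} (hs0 : 0 < s) (hs : s < 1) :
    Tendsto (fun n => lacoinTV p a b c π n (s * lacoinScale p n)) atTop (𝓝 1) := by
  obtain ⟨κ, hκ, hfast⟩ := exists_fast_travel_error hs0 hs
  have hlower : ∀ η > 0, ∀ᶠ n in atTop,
      1 - η ≤ lacoinTV p a b c π n (s * lacoinScale p n) := by
    intro η hη
    filter_upwards [eventually_ge_atTop 1,
      eventually_one_sub_le_prod_distribution hL hsum (half_pos hη),
      (tendsto_exp_neg_mul_natCast hκ).eventually_lt_const (half_pos hη)] with n hn hlast hexp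
    have ht := mul_nonneg hs0.le (lacoinScale_pos hp hn).le
    have htime := div_lacoinQ_mul_nonneg hp hn ht
    obtain ⟨i, hi⟩ := exists_eq_lacoinPhat p hn
    have htime_min : p n i / lacoinQ p n * (s * lacoinScale p n) = s * n := by
      rw [div_lacoinQ_mul_lacoinScale hp hn, hi, div_self (lacoinPhat_pos hp hn).ne', mul_one]
    have hprod := mul_le_of_le_one_right
      ((hL n i).continuousArrivalProb_nonneg hn (htime i) 0)
      (Finset.prod_le_one (s := Finset.univ.erase i)
        (fun j _ => (hL n j).continuousArrivalProb_nonneg hn (htime j) 0)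
        fun j _ => (hL n j).continuousArrivalProb_le_one hn (htime j) 0)
    rw [Finset.mul_prod_erase _ (fun j => continuousArrivalProb n (a n j) (b n j) (c n j)
      (p n j / lacoinQ p n * (s * lacoinScale p n)) 0) (Finset.mem_univ i), htime_min] at hprod
    linarith [prod_sub_prod_le_lacoinTV hp hL hn ht, hfast hn (hL n i)]
  refine tendsto_order.2 ⟨fun y hy => ?_, fun y hy => ?_⟩
  · filter_upwards [hlower ((1 - y) / 2) (by linarith)] with n hn
    linarith
  · filter_upwards [eventually_ge_atTop 1] with n hn
    exact (lacoinTV_le_one hp hL hn (mul_nonneg hs0.le (lacoinScale_pos hp hn).le)).trans_lt hy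

theorem lacoin_isCutoffProfile (hp : ∀ n i, 0 < p n i)
    (hL : ∀ n i, IsLacoinChain n (a n i) (b n i) (c n i) (π n i))
    (hsum : (fun n => ∑ i, a n i) =o[atTop] fun n : ℕ => 1 / (n : ℝ))
    {ξ : ℕ → ℕ} (hξ : IsSubsequence ξ) :
    IsCutoffProfile (fun k => lacoinScale p (ξ k)) (fun k => lacoinTV p a b c π (ξ k))
      (fun k => lacoinB p b (ξ k)) where
  scale_pos k := lacoinScale_pos hp (hξ.2 k)
  antitone k := (lacoinTV_antitone hp hL (hξ.2 k)).antitoneOn _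
  nonneg k t _ := lacoinTV_nonneg p a b c π (ξ k) t
  le_one k _ := lacoinTV_le_one hp hL (hξ.2 k)
  count_mono k := lacoinB_mono hp (fun n i => (hL n i).b_pos.le) (ξ k)
  count_nonneg k := lacoinB_nonneg (fun n i => (hL n i).b_pos.le) (ξ k)
  count_zero k := lacoinB_zero p b (ξ k)
  early _ hs0 hs := (tendsto_lacoinTV_one hp hL hsum hs0 hs).comp hξ.1.tendsto_atTop
  upper _ _ hs hδ _ hη :=
    hξ.1.tendsto_atTop.eventually (eventually_lacoinTV_le hp hL hsum hs hδ hη)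
  lower _ _ hs hδ _ hη :=
    hξ.1.tendsto_atTop.eventually (eventually_le_lacoinTV hp hL hsum hs hδ hη)

end Family

theorem proposition5p8_general {p a b c : ∀ n : ℕ, Fin n → ℝ}
    {π : ∀ n : ℕ, Fin n → Fin (2 * n + 1) → ℝ}
    (hp : ∀ n i, 0 < p n i)
    (hL : ∀ n i, IsLacoinChain n (a n i) (b n i) (c n i) (π n i))
    (hsum : (fun n : ℕ => ∑ i, a n i) =o[atTop] (fun n : ℕ => 1 / (n : ℝ))) :
    [ ∀ ξ, IsSubsequence ξ →
        thresholdZero (upperF p b ξ) = thresholdInfty (upperF p b ξ) ∧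
        thresholdZero (lowerF p b ξ) = thresholdInfty (lowerF p b ξ),
      ∀ ξ, IsSubsequence ξ →
        thresholdZero (upperF p b ξ) = thresholdInfty (upperF p b ξ) ∨
        thresholdZero (lowerF p b ξ) = thresholdInfty (lowerF p b ξ),
      HasCutoff (fun k => lacoinTV p a b c π (k + 1)) ].TFAE ∧
    (∀ Δ : ℝ,
      thresholdZero (upperF p b (fun k => k + 1)) = Δ →
      thresholdInfty (lowerF p b (fun k => k + 1)) = Δ →
      IsCutoffTime (fun k => lacoinTV p a b c π (k + 1))
        (fun k => 2 * (1 + Δ)⁻¹ * (lacoinQ p (k + 1) * ((k + 1 : ℕ) : ℝ)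
          / lacoinPhat p (k + 1)))) ∧
    (∀ Δ : ℝ,
      HasCutoff (fun k => lacoinTV p a b c π (k + 1)) →
      thresholdZero (lowerF p b (fun k => k + 1)) = Δ →
      thresholdInfty (upperF p b (fun k => k + 1)) = Δ →
      IsCutoffTime (fun k => lacoinTV p a b c π (k + 1))
        (fun k => 2 * (1 + Δ)⁻¹ * (lacoinQ p (k + 1) * ((k + 1 : ℕ) : ℝ)
          / lacoinPhat p (k + 1)))) ∧
    [ ∀ ξ, IsSubsequence ξ →
        thresholdZero (upperF p b ξ) < thresholdInfty (upperF p b ξ) ∧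
        thresholdZero (lowerF p b ξ) < thresholdInfty (lowerF p b ξ),
      ∀ ξ, IsSubsequence ξ →
        thresholdZero (upperF p b ξ) < thresholdInfty (upperF p b ξ) ∨
        thresholdZero (lowerF p b ξ) < thresholdInfty (lowerF p b ξ),
      ∀ ξ, IsSubsequence ξ →
        ¬ HasCutoff (fun k => lacoinTV p a b c π (ξ k)) ].TFAE := by
  have hprof := fun ξ (hξ : IsSubsequence ξ) => lacoin_isCutoffProfile hp hL hsum hξ
  have houter := fun Δ => (hprof _ isSubsequence_succ).isCutoffTime_of_outer (Δ := Δ)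
  refine ⟨?_, houter, fun Δ hcut hzero hinfty => ?_, ?_⟩
  · tfae_have 1 → 2 := fun h ξ hξ => Or.inl (h ξ hξ).1
    tfae_have 2 → 3 := fun h => (hprof _ isSubsequence_succ).hasCutoff_of_forall_subseq
      fun φ hφ => h _ (isSubsequence_succ.comp hφ)
    tfae_have 3 → 1 := fun hcut ξ hξ => (hprof ξ hξ).thresholds_eq_of_hasCutoff
      (HasCutoff.of_isSubsequence (d := lacoinTV p a b c π) hcut hξ)
    tfae_finish
  · obtain ⟨hupper, hlower⟩ := (hprof _ isSubsequence_succ).thresholds_eq_of_hasCutoff hcut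
    exact houter Δ (hupper.trans hinfty) (hlower.symm.trans hzero)
  · tfae_have 1 → 2 := fun h ξ hξ => Or.inl (h ξ hξ).1
    tfae_have 2 → 3 := fun h ξ hξ hcut =>
      have heq := (hprof ξ hξ).thresholds_eq_of_hasCutoff hcut
      (h ξ hξ).elim heq.1.not_lt heq.2.not_lt
    tfae_have 3 → 1 := fun hno ξ hξ => (hprof ξ hξ).thresholds_lt_of_forall_subseq
      fun φ hφ => hno _ (hξ.comp hφ)
    tfae_finish

/-- The arrays are indexed by `n ≥ 1` and `i : Fin n`; the family `𝒢` itself is the sequence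
`k ↦ 𝒢_{k+1}`, and the subfamily along `ξ` is the sequence `k ↦ 𝒢_{ξ k}`. -/
theorem proposition5p8
    (p a b c : ∀ n : ℕ, Fin n → ℝ)
    (π : ∀ n : ℕ, Fin n → Fin (2 * n + 1) → ℝ)
    (hp : ∀ n i, 0 < p n i)
    (ha : ∀ n i, 0 < a n i)
    (hab : ∀ n i, a n i < b n i)
    (hab' : ∀ n i, a n i + b n i < 1 / 2)
    (hc : ∀ n i, 0 ≤ c n i)
    (hac : ∀ n i, a n i + c n i ≤ 1)
    (hπ : ∀ n i, IsStationaryDistribution (lacoinKernel n (a n i) (b n i) (c n i)) (π n i))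
    (hrev : ∀ n i, IsReversibleChain (lacoinKernel n (a n i) (b n i) (c n i)) (π n i))
    (hsum : (fun n : ℕ => ∑ i, a n i) =o[atTop] (fun n : ℕ => 1 / (n : ℝ)))
    (hmax : (fun n : ℕ => ⨆ i, b n i) =o[atTop] (fun _ : ℕ => (1 : ℝ)))
    (hratio : (fun n : ℕ => ⨆ i, a n i / b n i) =O[atTop] (fun n : ℕ => 1 / (n : ℝ))) :
    -- criterion for a cutoff
    [ ∀ ξ, IsSubsequence ξ →
        thresholdZero (upperF p b ξ) = thresholdInfty (upperF p b ξ) ∧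
        thresholdZero (lowerF p b ξ) = thresholdInfty (lowerF p b ξ),
      ∀ ξ, IsSubsequence ξ →
        thresholdZero (upperF p b ξ) = thresholdInfty (upperF p b ξ) ∨
        thresholdZero (lowerF p b ξ) = thresholdInfty (lowerF p b ξ),
      HasCutoff (fun k => lacoinTV p a b c π (k + 1)) ].TFAE ∧
    -- the cutoff time, when the outer thresholds of the whole family agree
    (∀ Δ : ℝ,
      thresholdZero (upperF p b (fun k => k + 1)) = Δ →
      thresholdInfty (lowerF p b (fun k => k + 1)) = Δ →
      IsCutoffTime (fun k => lacoinTV p a b c π (k + 1))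
        (fun k => 2 * (1 + Δ)⁻¹ * (lacoinQ p (k + 1) * ((k + 1 : ℕ) : ℝ)
          / lacoinPhat p (k + 1)))) ∧
    -- the cutoff time, when there is a cutoff and the inner thresholds agree
    (∀ Δ : ℝ,
      HasCutoff (fun k => lacoinTV p a b c π (k + 1)) →
      thresholdZero (lowerF p b (fun k => k + 1)) = Δ →
      thresholdInfty (upperF p b (fun k => k + 1)) = Δ →
      IsCutoffTime (fun k => lacoinTV p a b c π (k + 1))
        (fun k => 2 * (1 + Δ)⁻¹ * (lacoinQ p (k + 1) * ((k + 1 : ℕ) : ℝ)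
          / lacoinPhat p (k + 1)))) ∧
    -- criterion for the absence of cutoffs in all subfamilies
    [ ∀ ξ, IsSubsequence ξ →
        thresholdZero (upperF p b ξ) < thresholdInfty (upperF p b ξ) ∧
        thresholdZero (lowerF p b ξ) < thresholdInfty (lowerF p b ξ),
      ∀ ξ, IsSubsequence ξ →
        thresholdZero (upperF p b ξ) < thresholdInfty (upperF p b ξ) ∨
        thresholdZero (lowerF p b ξ) < thresholdInfty (lowerF p b ξ),
      ∀ ξ, IsSubsequence ξ →
        ¬ HasCutoff (fun k => lacoinTV p a b c π (ξ k)) ].TFAE :=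
  proposition5p8_general hp
    (fun n i => ⟨ha n i, hab n i, hab' n i, hc n i, hac n i, hπ n i, hrev n i⟩) hsum
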